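/- Let $n\ge 2$ and let $\varphi:(0,\infty)\to\mathbb{R}$ be a $C^2$ function with $$\lim_{s\to\infty}\varphi(s)=\infty,\qquad \lim_{s\to\infty}\varphi'(s)=0,\qquad \lim_{s\to\infty}\varphi''(s)=0 .$$ Then there is a compactly supported function $u:\mathbb{R}^n\to\mathbb{R}$ that is twice differentiable at every point of $\mathbb{R}^n$ and has continuous Laplacian and bounded Hessian, but is not in $C^2(\mathbb{R}^n)$. Moreover, such functions can be built from $\varphi$ as follows. Let $\eta:[0,\infty)\to[0,1]$ be any non-increasing $C^\infty$ function with $\eta=1$ on $[0,\tfrac12]$ and $\eta=0$ on $[\tfrac23,\infty)$. For $t>0$ define $u_t:\mathbb{R}^n\to\mathbb{R}$ by $u_t(0)=0$, $u_t(x)=0$ for $|x|\ge 1$, and $$u_t(x)=\eta(|x|)\,x_1x_2\,|x|^{2t}\,\varphi(-\ln|x|^2)\qquad (0<|x|<1).$$ Let $\zeta_0=(\tfrac1{\sqrt2},\dots,\tfrac1{\sqrt2})\in\mathbb{R}^n$, let $(R_k)_{k\ge1}$ and $(r_k)_{k\ge1}$ be any non-increasing sequences of positive numbers tending to $0$ such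 that $R_k>r_k$ and $R_k-r_k>R_{k+1}+r_{k+1}$ for all $k$, and let $(t_k)_{k\ge1}$ be any sequence with $0<t_k<\tfrac14$ and $t_k\to0$. Then there are $\epsilon_k>0$ with $\epsilon_k\to0$ such that the function $$u(x)=\sum_{k=1}^\infty \epsilon_k r_k^2\,u_{t_k}\!\left(\frac{x-R_k\zeta_0}{r_k}\right)-\sum_{k=1}^\infty \epsilon_k r_k^2\,u_{t_k}\!\left(\frac{x+R_k\zeta_0}{r_k}\right)$$ is compactly supported and twice differentiable at every point of $\mathbb{R}^n$, has continuous Laplacian and bounded Hessian, and is not in $C^2(\mathbb{R}^n)$. -/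

import Mathlib

open Set Filter Topology
open scoped ContDiff

noncomputable section

/-- A `C²` profile `φ` on `(0, ∞)` with `φ(s) → ∞`, `φ'(s) → 0` and `φ''(s) → 0` as `s → ∞`. The
values of `φ` outside `(0, ∞)` play no role. -/
structure IsProfile (φ : ℝ → ℝ) : Prop where
  contDiffOn : ContDiffOn ℝ 2 φ (Ioi 0)
  tendsto_atTop : Tendsto φ atTop atTop
  tendsto_deriv : Tendsto (deriv φ) atTop (𝓝 0)
  tendsto_deriv_two : Tendsto (deriv (deriv φ)) atTop (𝓝 0)

/-- A non-increasing smooth cutoff `η : [0, ∞) → [0, 1]` that is `1` on `[0, 1/2]` and `0` on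
`[2/3, ∞)`. The values of `η` at negative numbers play no role. -/
structure IsCutoff (η : ℝ → ℝ) : Prop where
  contDiffOn : ContDiffOn ℝ ∞ η (Ici 0)
  antitoneOn : AntitoneOn η (Ici 0)
  mapsTo : MapsTo η (Ici 0) (Icc 0 1)
  eq_one : ∀ s, 0 ≤ s → s ≤ 1 / 2 → η s = 1
  eq_zero : ∀ s, 2 / 3 ≤ s → η s = 0

/-- Positive non-increasing sequences `R k → 0` (positions) and `r k → 0` (radii) with
`r k < R k` and `R (k + 1) + r (k + 1) < R k - r k`. -/
structure AreScales (R r : ℕ → ℝ) : Prop where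
  r_pos : ∀ k, 0 < r k
  r_lt_R : ∀ k, r k < R k
  antitone_R : Antitone R
  antitone_r : Antitone r
  tendsto_R : Tendsto R atTop (𝓝 0)
  tendsto_r : Tendsto r atTop (𝓝 0)
  gap : ∀ k, R (k + 1) + r (k + 1) < R k - r k

/-- The bump `u_t(x) = η(|x|) x₁ x₂ |x|^(2t) φ(-ln |x|²)` for `0 < |x| < 1`, extended by `0`. The
coordinates `x₁, x₂` are those with index `0, 1`. -/
def bump {n : ℕ} (hn : 2 ≤ n) (φ η : ℝ → ℝ) (t : ℝ) (x : EuclideanSpace ℝ (Fin n)) : ℝ :=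
  open Classical in
  if x = 0 then 0
  else if ‖x‖ < 1 then
    η ‖x‖ * (x ⟨0, by omega⟩ * x ⟨1, by omega⟩) * ‖x‖ ^ (2 * t) * φ (-Real.log (‖x‖ ^ 2))
  else 0

/-- The point `ζ₀ = (1/√2, …, 1/√2)` of `ℝⁿ`. -/
def diagPoint (n : ℕ) : EuclideanSpace ℝ (Fin n) :=
  WithLp.toLp 2 fun _ => 1 / Real.sqrt 2

/-- The function
`u(x) = ∑ₖ εₖ rₖ² u_{tₖ}((x - Rₖ ζ₀) / rₖ) - ∑ₖ εₖ rₖ² u_{tₖ}((x + Rₖ ζ₀) / rₖ)`. -/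
def bumpSum {n : ℕ} (hn : 2 ≤ n) (φ η : ℝ → ℝ) (R r t ε : ℕ → ℝ)
    (x : EuclideanSpace ℝ (Fin n)) : ℝ :=
  (∑' k, ε k * r k ^ 2 * bump hn φ η (t k) ((r k)⁻¹ • (x - R k • diagPoint n))) -
    ∑' k, ε k * r k ^ 2 * bump hn φ η (t k) ((r k)⁻¹ • (x + R k • diagPoint n))

/-- `u : ℝⁿ → ℝ` has compact support, is twice differentiable at every point, has continuous
Laplacian and bounded Hessian, but is not of class `C²`. -/
structure IsNonC2Example {n : ℕ} (u : EuclideanSpace ℝ (Fin n) → ℝ) : Prop where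
  hasCompactSupport : HasCompactSupport u
  differentiable : Differentiable ℝ u
  differentiable_fderiv : Differentiable ℝ (fderiv ℝ u)
  continuous_laplacian : Continuous (Laplacian.laplacian u : EuclideanSpace ℝ (Fin n) → ℝ)
  bounded_hessian : ∃ C : ℝ, ∀ x, ‖fderiv ℝ (fderiv ℝ u) x‖ ≤ C
  not_contDiff : ¬ ContDiff ℝ 2 u

end

/-! Put s = -log |x|². Then |x|^(2t) = e^(-ts) and η(|x|) = η(e^(-s/2)), so each bump is x₁x₂ g(s)
with g = e^(-ts) ψ(s), where ψ(s) = η(e^(-s/2)) φ(s) is `C²` on the whole line and has bounded ψ'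
and ψ''. Off the origin the Hessian is g times the constant Hessian of x₁x₂, plus an error
controlled by g' and g'' alone (`fderiv_fderiv_radialMul`). For t > 0 all of g, g', g'' tend to 0 as
s → ∞, so the bump is `C²` with zero Hessian at 0.

Everything rests on uniformity in t. The bounds on g' and g'' do not depend on t, whereas g tends to
the unbounded ψ as t → 0. Since x₁x₂ is harmonic, the g term has trace zero: the Laplacians stay
bounded by one constant K while the maximal Hessian norms Mₖ tend to infinity
(`isBump_radialMul_dampedProfile`, `eventually_exists_lt_abs_radialMul`).

Take εₖ = 1/(1 + Mₖ). The scaling ε r² w(·/r) multiplies Hessians by ε only, so in the sum Hessians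
are bounded by 1, while the k-th Laplacian is at most εₖK → 0, which gives continuity of the
Laplacian at 0. Values and gradients are o(|x|²) and o(|x|), so u is twice differentiable at 0 with
zero Hessian (`isTame_chainSum`). Yet points converging to 0 carry Hessians of norm at least 1/2
(`not_contDiff_chainSum_sub`). -/

/-! ### One-variable profiles and bounds uniform in the damping -/

/-- A continuous function vanishing on the negative axis and tending to `0` at `∞` is bounded. -/
lemma exists_abs_le_of_continuous_of_tendsto_zero {f : ℝ → ℝ} (hf : Continuous f)
    (hneg : ∀ s < 0, f s = 0) (hlim : Tendsto f atTop (𝓝 0)) : ∃ C, ∀ s, |f s| ≤ C := by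
  obtain ⟨a, ha⟩ := eventually_atTop.1 (hlim.eventually (Metric.ball_mem_nhds 0 one_pos))
  obtain ⟨C, hC⟩ := (isCompact_Icc (a := (0 : ℝ)) (b := a)).exists_bound_of_continuousOn
    hf.continuousOn
  refine ⟨max C 1, fun s => ?_⟩
  rcases lt_or_ge s 0 with h0 | h0
  · simp [hneg s h0]
  rcases le_or_gt s a with h1 | h1
  · exact (hC s ⟨h0, h1⟩).trans (le_max_left _ _)
  · have := ha s h1.le
    rw [dist_zero_right, Real.norm_eq_abs] at this
    exact this.le.trans (le_max_right _ _)

/-- A `C²` function on the line, vanishing for `s < 1/2`, with bounded first and second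
derivatives. -/
structure IsTamed (ψ : ℝ → ℝ) (C : ℝ) : Prop where
  contDiff : ContDiff ℝ 2 ψ
  eq_zero : ∀ s < 1 / 2, ψ s = 0
  abs_deriv_le : ∀ s, |deriv ψ s| ≤ C
  abs_deriv_two_le : ∀ s, |deriv (deriv ψ) s| ≤ C

lemma contDiff_one_deriv {ψ : ℝ → ℝ} (h : ContDiff ℝ 2 ψ) : ContDiff ℝ 1 (deriv ψ) := by
  have h' : ContDiff ℝ (1 + 1) ψ := by simpa [one_add_one_eq_two] using h
  exact (contDiff_succ_iff_deriv.1 h').2.2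

namespace IsTamed

variable {ψ : ℝ → ℝ} {C : ℝ}

lemma nonneg (h : IsTamed ψ C) : 0 ≤ C := (abs_nonneg _).trans (h.abs_deriv_le 0)

lemma eventuallyEq_zero (h : IsTamed ψ C) {s : ℝ} (hs : s < 1 / 2) : ψ =ᶠ[𝓝 s] fun _ => 0 := by
  filter_upwards [Iio_mem_nhds hs] with y hy using h.eq_zero y hy

lemma deriv_eq_zero (h : IsTamed ψ C) {s : ℝ} (hs : s < 1 / 2) : deriv ψ s = 0 := by
  rw [(h.eventuallyEq_zero hs).deriv_eq, deriv_const]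

lemma abs_le (h : IsTamed ψ C) (s : ℝ) : |ψ s| ≤ C * |s| := by
  have := Convex.norm_image_sub_le_of_norm_deriv_le (f := ψ) (s := univ) (x := 0) (y := s)
    (fun x _ => (h.contDiff.differentiable (by norm_num)).differentiableAt)
    (fun x _ => h.abs_deriv_le x) convex_univ trivial trivial
  simpa [h.eq_zero 0 (by norm_num)] using this

end IsTamed

/-- The cutoff kills `φ` near the end 0 of its domain, which makes the product `C²` on the whole
line. For large s the cutoff is 1, so the limits of `φ` and its derivatives carry over and the
derivatives are bounded. -/
lemma exists_isTamed {φ η : ℝ → ℝ} (hφ : IsProfile φ) (hη : IsCutoff η) :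
    (∃ C, IsTamed (fun s => η (Real.exp (-s / 2)) * φ s) C) ∧
      Tendsto (fun s => η (Real.exp (-s / 2)) * φ s) atTop atTop := by
  set ψ : ℝ → ℝ := fun s => η (Real.exp (-s / 2)) * φ s with hψ
  have hzero : ∀ s < 1 / 2, ψ s = 0 := by
    intro s hs
    have : (2 / 3 : ℝ) ≤ Real.exp (-s / 2) := by
      -- For s < 1/2 this gives e^(-s/2) ≥ 1 - s/2 > 3/4 > 2/3.
      have := Real.add_one_le_exp (-s / 2)
      linarith
    simp [hψ, hη.eq_zero _ this]
  have hev : ∀ s < 1 / 2, ψ =ᶠ[𝓝 s] fun _ => 0 := fun s hs => by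
    filter_upwards [Iio_mem_nhds hs] with y hy using hzero y hy
  have hcd : ContDiff ℝ 2 ψ := by
    rw [contDiff_iff_contDiffAt]
    intro s
    rcases lt_or_ge s (1 / 2) with hs | hs
    · exact contDiffAt_const.congr_of_eventuallyEq (hev s hs)
    · have h1 : ContDiffAt ℝ 2 φ s := hφ.contDiffOn.contDiffAt (Ioi_mem_nhds (by linarith))
      have h2 : ContDiffAt ℝ 2 η (Real.exp (-s / 2)) :=
        (hη.contDiffOn.contDiffAt (Ici_mem_nhds (Real.exp_pos _))).of_le (WithTop.coe_le_coe.2 (le_top : (2 : ℕ∞) ≤ ⊤))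
      have h3 : ContDiffAt ℝ 2 (fun s : ℝ => Real.exp (-s / 2)) s := by fun_prop
      exact (ContDiffAt.comp s h2 h3).mul h1
  have heq : ψ =ᶠ[atTop] φ := by
    filter_upwards [eventually_ge_atTop 2] with s hs
    have h1 : Real.exp (-s / 2) ≤ 1 / 2 := by
      have h2 := Real.add_one_le_exp (s / 2)
      rw [neg_div, Real.exp_neg, one_div]
      exact inv_anti₀ two_pos (by linarith)
    simp [hψ, hη.eq_one _ (Real.exp_pos _).le h1]
  have hloc : ∀ {f g : ℝ → ℝ}, f =ᶠ[atTop] g → deriv f =ᶠ[atTop] deriv g := by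
    intro f g hfg
    obtain ⟨a, ha⟩ := eventually_atTop.1 hfg
    filter_upwards [eventually_gt_atTop a] with s hs
    refine Filter.EventuallyEq.deriv_eq ?_
    filter_upwards [Ioi_mem_nhds hs] with y hy using ha y (le_of_lt hy)
  have hd0 : ∀ s < 1 / 2, deriv ψ s = 0 := fun s hs => by
    rw [(hev s hs).deriv_eq, deriv_const]
  have hd1 : ∀ s < 1 / 2, deriv (deriv ψ) s = 0 := fun s hs => by
    have : deriv ψ =ᶠ[𝓝 s] fun _ => 0 := by
      filter_upwards [Iio_mem_nhds hs] with y hy using hd0 y hy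
    rw [this.deriv_eq, deriv_const]
  have hcd1 := contDiff_one_deriv hcd
  obtain ⟨C₁, h₁⟩ := exists_abs_le_of_continuous_of_tendsto_zero hcd1.continuous
    (fun s hs => hd0 s (by linarith)) (hφ.tendsto_deriv.congr' (hloc heq).symm)
  obtain ⟨C₂, h₂⟩ := exists_abs_le_of_continuous_of_tendsto_zero
    (hcd1.continuous_deriv le_rfl)
    (fun s hs => hd1 s (by linarith)) (hφ.tendsto_deriv_two.congr' (hloc (hloc heq)).symm)
  refine ⟨⟨max C₁ C₂, hcd, hzero, fun s => (h₁ s).trans (le_max_left _ _),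
    fun s => (h₂ s).trans (le_max_right _ _)⟩,
    hφ.tendsto_atTop.congr' heq.symm⟩

/-- The profile `e^{-ts} ψ(s)`. -/
noncomputable def dampedProfile (ψ : ℝ → ℝ) (t s : ℝ) : ℝ := Real.exp (-(t * s)) * ψ s

namespace IsTamed

variable {ψ : ℝ → ℝ} {C t : ℝ}

lemma contDiff_dampedProfile (h : IsTamed ψ C) (t : ℝ) : ContDiff ℝ 2 (dampedProfile ψ t) := by
  have := h.contDiff
  unfold dampedProfile
  fun_prop

lemma deriv_dampedProfile (h : IsTamed ψ C) (t : ℝ) :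
    deriv (dampedProfile ψ t) = fun s => Real.exp (-(t * s)) * (deriv ψ s - t * ψ s) := by
  funext s
  have h1 : HasDerivAt (fun s => Real.exp (-(t * s))) (Real.exp (-(t * s)) * (-(t * 1))) s :=
    (((hasDerivAt_id s).const_mul t).neg).exp
  have h2 := (h.contDiff.differentiable (by norm_num) s).hasDerivAt
  rw [show deriv (dampedProfile ψ t) s = _ from (h1.mul h2).deriv]
  ring

lemma deriv_deriv_dampedProfile (h : IsTamed ψ C) (t : ℝ) :
    deriv (deriv (dampedProfile ψ t)) = fun s =>
      Real.exp (-(t * s)) * (deriv (deriv ψ) s - 2 * t * deriv ψ s + t ^ 2 * ψ s) := by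
  rw [h.deriv_dampedProfile]
  funext s
  have h1 : HasDerivAt (fun s => Real.exp (-(t * s))) (Real.exp (-(t * s)) * (-(t * 1))) s :=
    (((hasDerivAt_id s).const_mul t).neg).exp
  have h2 := (h.contDiff.differentiable (by norm_num) s).hasDerivAt
  have h3 := ((contDiff_one_deriv h.contDiff).differentiable (by norm_num) s).hasDerivAt
  rw [show deriv (fun s => Real.exp (-(t * s)) * (deriv ψ s - t * ψ s)) s = _ from
    (h1.mul (h3.sub (h2.const_mul t))).deriv]
  simp only [Pi.sub_apply]
  ring

lemma deriv_deriv_eq_zero (h : IsTamed ψ C) {s : ℝ} (hs : s < 1 / 2) :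
    deriv (deriv ψ) s = 0 := by
  have : deriv ψ =ᶠ[𝓝 s] fun _ => 0 := by
    filter_upwards [Iio_mem_nhds hs] with y hy using h.deriv_eq_zero hy
  rw [this.deriv_eq, deriv_const]

lemma abs_dampedProfile_le (h : IsTamed ψ C) {s : ℝ} (hs : 0 ≤ s) :
    |dampedProfile ψ t s| ≤ Real.exp (-(t * s)) * (C * s) := by
  rw [dampedProfile, abs_mul, Real.abs_exp]
  gcongr
  simpa [abs_of_nonneg hs] using h.abs_le s

/-- Differentiating the exponential costs a factor t and ψ grows at most linearly, so t and s enter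
only through ts, which e^(-ts) absorbs. Hence the later bounds free of t. -/
lemma abs_deriv_dampedProfile_le' (h : IsTamed ψ C) (ht : 0 ≤ t) {s : ℝ} (hs : 0 ≤ s) :
    |deriv (dampedProfile ψ t) s| ≤ Real.exp (-(t * s)) * (C + C * (t * s)) := by
  rw [h.deriv_dampedProfile, abs_mul, Real.abs_exp]
  gcongr
  have h0 := h.abs_le s
  rw [abs_of_nonneg hs] at h0
  refine (abs_sub _ _).trans (add_le_add (h.abs_deriv_le s) ?_)
  rw [abs_mul, abs_of_nonneg ht]
  calc t * |ψ s| ≤ t * (C * s) := by gcongr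
    _ = _ := by ring

lemma abs_deriv_deriv_dampedProfile_le' (h : IsTamed ψ C) (ht : 0 ≤ t) (ht1 : t ≤ 1) {s : ℝ}
    (hs : 0 ≤ s) :
    |deriv (deriv (dampedProfile ψ t)) s| ≤ Real.exp (-(t * s)) * (3 * C + C * (t * s)) := by
  rw [h.deriv_deriv_dampedProfile, abs_mul, Real.abs_exp]
  gcongr
  have h0 := h.abs_le s
  have hC := h.nonneg
  rw [abs_of_nonneg hs] at h0
  refine (abs_add_le _ _).trans (add_le_add ((abs_sub _ _).trans ?_) ?_)
  · rw [abs_mul, abs_of_nonneg (by positivity : 0 ≤ 2 * t)]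
    have h1 : 2 * t * |deriv ψ s| ≤ 2 * 1 * C := by
      gcongr
      exact h.abs_deriv_le s
    linarith [h.abs_deriv_two_le s]
  · rw [abs_mul, abs_of_nonneg (by positivity : 0 ≤ t ^ 2)]
    calc t ^ 2 * |ψ s| ≤ t ^ 2 * (C * s) := by gcongr
      _ = t * (C * (t * s)) := by ring
      _ ≤ 1 * (C * (t * s)) := by gcongr
      _ = _ := one_mul _

lemma exp_neg_mul_affine_le {a b x : ℝ} (ha : 0 ≤ a) (hb : 0 ≤ b) (hx : 0 ≤ x) :
    Real.exp (-x) * (a + b * x) ≤ a + b := by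
  have h1 : Real.exp (-x) ≤ 1 := Real.exp_le_one_iff.2 (by linarith)
  have h2 : Real.exp (-x) * x ≤ 1 := by
    have := Real.add_one_le_exp x
    rw [Real.exp_neg, inv_mul_le_iff₀ (Real.exp_pos x)]
    linarith
  nlinarith

lemma abs_deriv_dampedProfile_le (h : IsTamed ψ C) (ht : 0 ≤ t) (s : ℝ) :
    |deriv (dampedProfile ψ t) s| ≤ 2 * C := by
  have hC := h.nonneg
  rcases lt_or_ge s 0 with hs | hs
  · have hs' : s < 1 / 2 := by linarith
    rw [h.deriv_dampedProfile]
    simp [h.deriv_eq_zero hs', h.eq_zero s hs', hC]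
  · have := exp_neg_mul_affine_le hC hC (mul_nonneg ht hs)
    linarith [h.abs_deriv_dampedProfile_le' ht hs]

lemma abs_deriv_deriv_dampedProfile_le (h : IsTamed ψ C) (ht : 0 ≤ t) (ht1 : t ≤ 1) (s : ℝ) :
    |deriv (deriv (dampedProfile ψ t)) s| ≤ 4 * C := by
  have hC := h.nonneg
  rcases lt_or_ge s 0 with hs | hs
  · have hs' : s < 1 / 2 := by linarith
    rw [h.deriv_deriv_dampedProfile]
    simp [h.deriv_eq_zero hs', h.eq_zero s hs', h.deriv_deriv_eq_zero hs', hC]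
  · have := exp_neg_mul_affine_le (a := 3 * C) (by positivity) hC (mul_nonneg ht hs)
    linarith [h.abs_deriv_deriv_dampedProfile_le' ht ht1 hs]

/-- The profile itself has no bound uniform in t when ψ is unbounded; one power of |x| = e^(-s/2)
restores it. This controls values and gradients of the bumps. -/
lemma exp_mul_abs_dampedProfile_le (h : IsTamed ψ C) (ht : 0 ≤ t) (s : ℝ) :
    Real.exp (-s / 2) * |dampedProfile ψ t s| ≤ 2 * C := by
  have hC := h.nonneg
  rcases lt_or_ge s 0 with hs | hs
  · simp [dampedProfile, h.eq_zero s (by linarith), hC]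
  · have h1 : Real.exp (-(t * s)) ≤ 1 := Real.exp_le_one_iff.2 (by nlinarith)
    have h2 := exp_neg_mul_affine_le (a := 0) (b := 2 * C) le_rfl (by positivity)
      (by positivity : 0 ≤ s / 2)
    calc Real.exp (-s / 2) * |dampedProfile ψ t s|
        ≤ Real.exp (-s / 2) * (1 * (C * s)) := by
          gcongr
          exact (h.abs_dampedProfile_le hs).trans (by gcongr)
      _ = Real.exp (-(s / 2)) * (0 + 2 * C * (s / 2)) := by
          rw [neg_div]; ring
      _ ≤ _ := by linarith

lemma tendsto_exp_neg_mul_affine (ht : 0 < t) (a b : ℝ) :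
    Tendsto (fun s => Real.exp (-(t * s)) * (a + b * (t * s))) atTop (𝓝 0) := by
  have h0 : Tendsto (fun s : ℝ => t * s) atTop atTop := tendsto_id.const_mul_atTop ht
  have h1 := (Real.tendsto_pow_mul_exp_neg_atTop_nhds_zero 0).comp h0
  have h2 := (Real.tendsto_pow_mul_exp_neg_atTop_nhds_zero 1).comp h0
  have := (h1.const_mul a).add (h2.const_mul b)
  simp only [mul_zero, add_zero] at this
  refine this.congr fun s => ?_
  simp only [Function.comp_apply, pow_zero, pow_one]
  ring

lemma tendsto_dampedProfile (h : IsTamed ψ C) (ht : 0 < t) :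
    Tendsto (dampedProfile ψ t) atTop (𝓝 0) := by
  refine squeeze_zero_norm' ?_ (tendsto_exp_neg_mul_affine ht 0 (C / t))
  filter_upwards [eventually_ge_atTop 0] with s hs
  refine (h.abs_dampedProfile_le hs).trans (le_of_eq ?_)
  field_simp
  ring

lemma tendsto_deriv_dampedProfile (h : IsTamed ψ C) (ht : 0 < t) :
    Tendsto (deriv (dampedProfile ψ t)) atTop (𝓝 0) := by
  refine squeeze_zero_norm' ?_ (tendsto_exp_neg_mul_affine ht C C)
  filter_upwards [eventually_ge_atTop 0] with s hs using h.abs_deriv_dampedProfile_le' ht.le hs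

lemma tendsto_deriv_deriv_dampedProfile (h : IsTamed ψ C) (ht : 0 < t) (ht1 : t ≤ 1) :
    Tendsto (deriv (deriv (dampedProfile ψ t))) atTop (𝓝 0) := by
  refine squeeze_zero_norm' ?_ (tendsto_exp_neg_mul_affine ht (3 * C) C)
  filter_upwards [eventually_ge_atTop 0] with s hs using
    h.abs_deriv_deriv_dampedProfile_le' ht.le ht1 hs

end IsTamed

/-! ### Norms of bilinear forms -/

section

variable {E : Type*} [NormedAddCommGroup E] [NormedSpace ℝ E]

lemma norm_bilin_add_le (X Y : E →L[ℝ] E →L[ℝ] ℝ) : ‖X + Y‖ ≤ ‖X‖ + ‖Y‖ := X.opNorm_add_le Y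

lemma norm_bilin_smul_le (c : ℝ) (X : E →L[ℝ] E →L[ℝ] ℝ) : ‖c • X‖ ≤ |c| * ‖X‖ :=
  X.opNorm_smul_le c

lemma norm_bilin_smul (c : ℝ) (X : E →L[ℝ] E →L[ℝ] ℝ) : ‖c • X‖ = |c| * ‖X‖ := by
  rcases eq_or_ne c 0 with rfl | hc
  · have h : (0 : ℝ) • X = 0 := by ext; simp
    rw [h, abs_zero, zero_mul]
    exact ContinuousLinearMap.opNorm_zero
  · refine (norm_bilin_smul_le c X).antisymm ?_
    have h := norm_bilin_smul_le c⁻¹ (c • X)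
    rw [smul_smul, inv_mul_cancel₀ hc, one_smul, abs_inv] at h
    have hc' : 0 < |c| := abs_pos.2 hc
    calc |c| * ‖X‖ ≤ |c| * (|c|⁻¹ * ‖c • X‖) := by gcongr
      _ = _ := by field_simp

lemma norm_bilin_sub_le (X Y : E →L[ℝ] E →L[ℝ] ℝ) : ‖X - Y‖ ≤ ‖X‖ + ‖Y‖ := norm_sub_le X Y

end

/-! ### Gradient and Hessian of p q g(-log |x|²) off the origin -/

/-- The function `x ↦ p(x) q(x) g(-log |x|²)`. -/
noncomputable def radialMul {E : Type*} [NormedAddCommGroup E] [InnerProductSpace ℝ E]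
    (p q : E →L[ℝ] ℝ) (g : ℝ → ℝ) (x : E) : ℝ :=
  p x * q x * g (-Real.log (‖x‖ ^ 2))

/-- The second derivative of `x ↦ p(x) q(x)`. -/
noncomputable def mulHessian {E : Type*} [NormedAddCommGroup E] [InnerProductSpace ℝ E]
    (p q : E →L[ℝ] ℝ) : E →L[ℝ] E →L[ℝ] ℝ :=
  p.smulRight q + q.smulRight p

section

variable {E : Type*} [NormedAddCommGroup E] [InnerProductSpace ℝ E]
  {p q : E →L[ℝ] ℝ} {g : ℝ → ℝ}

lemma abs_apply_le_norm {p : E →L[ℝ] ℝ} (hp : ‖p‖ ≤ 1) (x : E) : |p x| ≤ ‖x‖ := by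
  simpa using p.le_of_opNorm_le hp x

lemma abs_mul_apply_le (hp : ‖p‖ ≤ 1) (hq : ‖q‖ ≤ 1) (x : E) : |p x * q x| ≤ ‖x‖ ^ 2 := by
  rw [abs_mul, sq]
  exact mul_le_mul (abs_apply_le_norm hp x) (abs_apply_le_norm hq x) (abs_nonneg _)
    (norm_nonneg _)

lemma norm_mulHessian_apply_le (hp : ‖p‖ ≤ 1) (hq : ‖q‖ ≤ 1) (x : E) :
    ‖mulHessian p q x‖ ≤ 2 * ‖x‖ := by
  have h1 := abs_apply_le_norm hp x
  have h2 := abs_apply_le_norm hq x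
  have h0 : mulHessian p q x = p x • q + q x • p := by simp [mulHessian]
  rw [h0]
  refine (norm_add_le _ _).trans ?_
  rw [norm_smul, norm_smul, Real.norm_eq_abs, Real.norm_eq_abs]
  nlinarith [norm_nonneg p, norm_nonneg q, abs_nonneg (p x), abs_nonneg (q x)]

lemma norm_mulHessian_le (hp : ‖p‖ ≤ 1) (hq : ‖q‖ ≤ 1) : ‖mulHessian p q‖ ≤ 2 :=
  ContinuousLinearMap.opNorm_le_bound _ zero_le_two (norm_mulHessian_apply_le hp hq)

lemma hasFDerivAt_mul_apply (p q : E →L[ℝ] ℝ) (x : E) :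
    HasFDerivAt (fun x => p x * q x) (mulHessian p q x) x := by
  refine (p.hasFDerivAt.mul q.hasFDerivAt).congr_fderiv ?_
  simp [mulHessian]

lemma hasFDerivAt_neg_log_norm_sq {x : E} (hx : x ≠ 0) :
    HasFDerivAt (fun x : E => -Real.log (‖x‖ ^ 2)) ((-2 / ‖x‖ ^ 2) • innerSL ℝ x) x := by
  have hx' : ‖x‖ ^ 2 ≠ 0 := by positivity
  refine (((hasStrictFDerivAt_norm_sq x).hasFDerivAt.log hx').neg).congr_fderiv ?_
  ext y
  simp
  ring

lemma tendsto_neg_log_norm_sq {E : Type*} [NormedAddCommGroup E] :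
    Tendsto (fun x : E => -Real.log (‖x‖ ^ 2)) (𝓝[≠] 0) atTop := by
  refine tendsto_neg_atBot_atTop.comp (Real.tendsto_log_nhdsGT_zero.comp ?_)
  refine tendsto_nhdsWithin_iff.2 ⟨?_, ?_⟩
  · have : Continuous fun x : E => ‖x‖ ^ 2 := by fun_prop
    simpa using (this.tendsto 0).mono_left nhdsWithin_le_nhds
  · filter_upwards [self_mem_nhdsWithin] with x hx
    have : x ≠ 0 := hx
    exact mem_Ioi.2 (by positivity)

/-- The gradient of `radialMul p q g`. -/
noncomputable def radialGrad (p q : E →L[ℝ] ℝ) (g : ℝ → ℝ) (x : E) : E →L[ℝ] ℝ :=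
  g (-Real.log (‖x‖ ^ 2)) • mulHessian p q x +
    (-2 * deriv g (-Real.log (‖x‖ ^ 2)) * (p x * q x / ‖x‖ ^ 2)) • innerSL ℝ x

lemma hasFDerivAt_radialMul (hg : ContDiff ℝ 2 g) {x : E} (hx : x ≠ 0) :
    HasFDerivAt (radialMul p q g) (radialGrad p q g x) x := by
  have h1 := (hg.differentiable (by norm_num) (-Real.log (‖x‖ ^ 2))).hasDerivAt
  have h2 := h1.comp_hasFDerivAt x (hasFDerivAt_neg_log_norm_sq hx)
  refine ((hasFDerivAt_mul_apply p q x).mul h2).congr_fderiv ?_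
  ext y
  simp [radialGrad]
  ring

lemma contDiffAt_radialMul (hg : ContDiff ℝ 2 g) {x : E} (hx : x ≠ 0) :
    ContDiffAt ℝ 2 (radialMul p q g) x := by
  have hx' : ‖x‖ ^ 2 ≠ 0 := by positivity
  have h1 : ContDiffAt ℝ 2 (fun x : E => -Real.log (‖x‖ ^ 2)) x :=
    ((contDiff_norm_sq ℝ).contDiffAt.log hx').neg
  have h2 : ContDiffAt ℝ 2 (fun x : E => p x * q x) x :=
    (p.contDiff.mul q.contDiff).contDiffAt
  exact h2.mul (hg.contDiffAt.comp x h1)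

lemma norm_radialGrad_le (hp : ‖p‖ ≤ 1) (hq : ‖q‖ ≤ 1) (g : ℝ → ℝ) (x : E) :
    ‖radialGrad p q g x‖ ≤
      2 * (|g (-Real.log (‖x‖ ^ 2))| + |deriv g (-Real.log (‖x‖ ^ 2))|) * ‖x‖ := by
  set s := -Real.log (‖x‖ ^ 2) with hs
  have h1 : |p x * q x / ‖x‖ ^ 2| ≤ 1 := by
    rw [abs_div, abs_of_nonneg (by positivity : (0 : ℝ) ≤ ‖x‖ ^ 2)]
    exact div_le_one_of_le₀ (abs_mul_apply_le hp hq x) (by positivity)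
  rw [radialGrad]
  refine (norm_add_le _ _).trans ?_
  rw [norm_smul, norm_smul, innerSL_apply_norm, ← hs, Real.norm_eq_abs, Real.norm_eq_abs, abs_mul,
    abs_mul]
  have h2 : |g s| * ‖mulHessian p q x‖ ≤ |g s| * (2 * ‖x‖) := by
    gcongr
    exact norm_mulHessian_apply_le hp hq x
  have h3 : |(-2 : ℝ)| * |deriv g s| * |p x * q x / ‖x‖ ^ 2| * ‖x‖ ≤ 2 * |deriv g s| * 1 * ‖x‖ := by
    gcongr
    norm_num
  linarith

lemma hasFDerivAt_mul_apply_div {x : E} (hx : x ≠ 0) :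
    HasFDerivAt (fun x => p x * q x / ‖x‖ ^ 2) ((‖x‖ ^ 2)⁻¹ • mulHessian p q x +
      (-2 * (p x * q x) / (‖x‖ ^ 2) ^ 2) • innerSL ℝ x) x := by
  have hx2 : ‖x‖ ^ 2 ≠ 0 := by positivity
  have h1 := (hasFDerivAt_mul_apply p q x).mul
    ((hasDerivAt_inv hx2).comp_hasFDerivAt x (hasStrictFDerivAt_norm_sq x).hasFDerivAt)
  refine (h1.congr_of_eventuallyEq (.of_forall fun y => ?_)).congr_fderiv ?_
  · simp [div_eq_mul_inv]
  · ext y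
    simp
    ring

/-- The quotient p q / |x|² is homogeneous of degree 0, so its gradient has size 1/|x|. -/
lemma norm_fderiv_mul_apply_div_le (hp : ‖p‖ ≤ 1) (hq : ‖q‖ ≤ 1) {x : E} (hx : x ≠ 0) :
    ‖(‖x‖ ^ 2)⁻¹ • mulHessian p q x + (-2 * (p x * q x) / (‖x‖ ^ 2) ^ 2) • innerSL ℝ x‖ ≤
      4 / ‖x‖ := by
  have hx0 : 0 < ‖x‖ := norm_pos_iff.2 hx
  refine (norm_add_le _ _).trans ?_
  rw [norm_smul, norm_smul, innerSL_apply_norm, norm_inv, norm_div, norm_mul, norm_neg, norm_pow,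
    norm_pow, norm_pow, norm_norm, Real.norm_ofNat, Real.norm_eq_abs]
  calc (‖x‖ ^ 2)⁻¹ * ‖mulHessian p q x‖ + 2 * |p x * q x| / (‖x‖ ^ 2) ^ 2 * ‖x‖
      ≤ (‖x‖ ^ 2)⁻¹ * (2 * ‖x‖) + 2 * ‖x‖ ^ 2 / (‖x‖ ^ 2) ^ 2 * ‖x‖ := by
        gcongr
        · exact norm_mulHessian_apply_le hp hq x
        · exact abs_mul_apply_le hp hq x
    _ = _ := by field_simp; ring

/-- Only the term in which both derivatives fall on p q contains g undifferentiated. Every other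
term has g' or g'' times a coefficient homogeneous of degree 0, so the bound on `T` has no separate
dependence on |x|. -/
lemma fderiv_fderiv_radialMul (hp : ‖p‖ ≤ 1) (hq : ‖q‖ ≤ 1) (hg : ContDiff ℝ 2 g) {x : E}
    (hx : x ≠ 0) :
    ∃ T : E →L[ℝ] E →L[ℝ] ℝ,
      fderiv ℝ (fderiv ℝ (radialMul p q g)) x =
        g (-Real.log (‖x‖ ^ 2)) • mulHessian p q + T ∧
      ‖T‖ ≤ 14 * |deriv g (-Real.log (‖x‖ ^ 2))| + 4 * |deriv (deriv g) (-Real.log (‖x‖ ^ 2))| := by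
  have hev : fderiv ℝ (radialMul p q g) =ᶠ[𝓝 x] radialGrad p q g := by
    filter_upwards [isOpen_ne.mem_nhds hx] with y hy using (hasFDerivAt_radialMul hg hy).fderiv
  have hx0 : 0 < ‖x‖ := norm_pos_iff.2 hx
  have hx2 : ‖x‖ ^ 2 ≠ 0 := by positivity
  set s := -Real.log (‖x‖ ^ 2) with hs
  set L : E →L[ℝ] ℝ := (-2 / ‖x‖ ^ 2) • innerSL ℝ x with hL
  have hLd : HasFDerivAt (fun x : E => -Real.log (‖x‖ ^ 2)) L x := hasFDerivAt_neg_log_norm_sq hx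
  have hg0 := (hg.differentiable (by norm_num) s).hasDerivAt.comp_hasFDerivAt x hLd
  have hg1 := ((contDiff_one_deriv hg).differentiable (by norm_num)
    s).hasDerivAt.comp_hasFDerivAt x hLd
  obtain ⟨D, hD, hDn⟩ : ∃ D : E →L[ℝ] ℝ,
      HasFDerivAt (fun x => p x * q x / ‖x‖ ^ 2) D x ∧ ‖D‖ ≤ 4 / ‖x‖ :=
    ⟨_, hasFDerivAt_mul_apply_div hx, norm_fderiv_mul_apply_div_le hp hq hx⟩
  -- `innerSL` is conjugate-linear by its type; `J` is the same map seen as real-linear, so that it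
  -- can serve as a derivative.
  obtain ⟨J, hJx, hJ⟩ : ∃ J : E →L[ℝ] E →L[ℝ] ℝ, (∀ y, J y = innerSL ℝ y) ∧ ‖J‖ ≤ 1 :=
    ⟨innerSL ℝ, fun _ => rfl,
      ContinuousLinearMap.opNorm_le_bound _ zero_le_one fun y => by simp⟩
  have hI : HasFDerivAt (fun x : E => innerSL ℝ x) J x :=
    J.hasFDerivAt.congr_of_eventuallyEq (.of_forall fun y => (hJx y).symm)
  have h1 := hg0.smul (mulHessian p q).hasFDerivAt
  have h2 := ((hg1.const_mul (-2)).mul hD).smul hI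
  rw [hev.fderiv_eq, show fderiv ℝ (radialGrad p q g) x = _ from (h1.add h2).fderiv]
  refine ⟨_, add_assoc _ _ _, ?_⟩
  have hA := norm_mulHessian_apply_le hp hq x
  have hH : |p x * q x / ‖x‖ ^ 2| ≤ 1 := by
    rw [abs_div, abs_of_nonneg (by positivity : (0 : ℝ) ≤ ‖x‖ ^ 2)]
    exact div_le_one_of_le₀ (abs_mul_apply_le hp hq x) (by positivity)
  have hLn : ‖L‖ = 2 / ‖x‖ := by
    rw [hL, norm_smul, innerSL_apply_norm, norm_div, norm_pow, norm_norm, norm_neg,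
      Real.norm_ofNat]
    field_simp
  have e1 : ‖(deriv g s • L).smulRight (mulHessian p q x)‖ ≤ 4 * |deriv g s| := by
    rw [ContinuousLinearMap.norm_smulRight_apply, norm_smul, hLn, Real.norm_eq_abs]
    calc |deriv g s| * (2 / ‖x‖) * ‖mulHessian p q x‖
        ≤ |deriv g s| * (2 / ‖x‖) * (2 * ‖x‖) := by gcongr
      _ = _ := by field_simp; ring
  have e2 : ‖(-2 * deriv g s * (p x * q x / ‖x‖ ^ 2)) • J‖ ≤
      2 * |deriv g s| := by
    refine (norm_bilin_smul_le _ _).trans ?_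
    rw [abs_mul, abs_mul, abs_neg, abs_two]
    calc 2 * |deriv g s| * |p x * q x / ‖x‖ ^ 2| * ‖J‖
        ≤ 2 * |deriv g s| * 1 * 1 := by gcongr
      _ = _ := by ring
  have e3 : ‖((-2 * deriv g s) • D + (p x * q x / ‖x‖ ^ 2) •
      ((-2 : ℝ) • deriv (deriv g) s • L)).smulRight (innerSL ℝ x)‖ ≤
      8 * |deriv g s| + 4 * |deriv (deriv g) s| := by
    rw [ContinuousLinearMap.norm_smulRight_apply, innerSL_apply_norm]
    have e4 := norm_add_le ((-2 * deriv g s) • D)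
      ((p x * q x / ‖x‖ ^ 2) • ((-2 : ℝ) • deriv (deriv g) s • L))
    rw [norm_smul, norm_smul, norm_smul, norm_smul, hLn, norm_mul, norm_neg, Real.norm_ofNat,
      Real.norm_eq_abs, Real.norm_eq_abs, Real.norm_eq_abs] at e4
    have e5 : 2 * |deriv g s| * ‖D‖ + |p x * q x / ‖x‖ ^ 2| *
        (2 * (|deriv (deriv g) s| * (2 / ‖x‖))) ≤
        2 * |deriv g s| * (4 / ‖x‖) + 1 * (2 * (|deriv (deriv g) s| * (2 / ‖x‖))) := by
      gcongr
    calc _ ≤ (2 * |deriv g s| * (4 / ‖x‖) + 1 * (2 * (|deriv (deriv g) s| * (2 / ‖x‖)))) * ‖x‖ := by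
          gcongr
          exact e4.trans e5
      _ = _ := by field_simp; ring
  have e6 : ∀ {X Y Z : E →L[ℝ] E →L[ℝ] ℝ} {a b c : ℝ}, ‖X‖ ≤ a → ‖Y‖ ≤ b → ‖Z‖ ≤ c →
      ‖X + (Y + Z)‖ ≤ a + (b + c) := fun hX hY hZ =>
    (norm_bilin_add_le _ _).trans (add_le_add hX ((norm_bilin_add_le _ _).trans (add_le_add hY hZ)))
  -- The coefficient 14 is 4 + 2 + 8, from `e1`, `e2` and `e3`.
  exact (e6 e1 e2 e3).trans (by linarith)

end

lemma hasFDerivAt_zero_of_norm_le {E F : Type*} [NormedAddCommGroup E] [NormedSpace ℝ E]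
    [NormedAddCommGroup F] [NormedSpace ℝ F] {f : E → F} (hf : f 0 = 0)
    (h : ∀ δ > 0, ∀ᶠ x in 𝓝[≠] (0 : E), ‖f x‖ ≤ δ * ‖x‖) : HasFDerivAt f (0 : E →L[ℝ] F) 0 := by
  rw [hasFDerivAt_iff_isLittleO_nhds_zero, Asymptotics.isLittleO_iff]
  intro δ hδ
  have h1 := eventually_nhdsWithin_iff.1 (h δ hδ)
  filter_upwards [h1] with x hx
  rcases eq_or_ne x 0 with rfl | hx0
  · simp
  · simpa [hf] using hx hx0

/-! ### Traces, regularity at the origin and uniform bump bounds -/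

section

variable {E : Type*} [NormedAddCommGroup E] [InnerProductSpace ℝ E]

/-- The trace of a bilinear form in an orthonormal basis. -/
noncomputable def bilinTrace {ι : Type*} [Fintype ι] (b : OrthonormalBasis ι ℝ E)
    (B : E →L[ℝ] E →L[ℝ] ℝ) : ℝ := ∑ i, B (b i) (b i)

variable {ι : Type*} [Fintype ι] {b : OrthonormalBasis ι ℝ E}

lemma abs_bilinTrace_le (b : OrthonormalBasis ι ℝ E) (B : E →L[ℝ] E →L[ℝ] ℝ) :
    |bilinTrace b B| ≤ Fintype.card ι * ‖B‖ := by
  refine (Finset.abs_sum_le_sum_abs _ _).trans ?_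
  have : ∀ i ∈ Finset.univ, |B (b i) (b i)| ≤ ‖B‖ := fun i _ => by
    simpa using B.le_opNorm₂ (b i) (b i)
  simpa using Finset.sum_le_card_nsmul _ _ _ this

lemma continuous_bilinTrace (b : OrthonormalBasis ι ℝ E) : Continuous (bilinTrace b) := by
  unfold bilinTrace
  fun_prop

lemma bilinTrace_add (B B' : E →L[ℝ] E →L[ℝ] ℝ) :
    bilinTrace b (B + B') = bilinTrace b B + bilinTrace b B' := by
  simp [bilinTrace, Finset.sum_add_distrib]

lemma bilinTrace_sub (B B' : E →L[ℝ] E →L[ℝ] ℝ) :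
    bilinTrace b (B - B') = bilinTrace b B - bilinTrace b B' := by
  simp [bilinTrace, Finset.sum_sub_distrib]

lemma bilinTrace_smul (c : ℝ) (B : E →L[ℝ] E →L[ℝ] ℝ) :
    bilinTrace b (c • B) = c * bilinTrace b B := by
  simp [bilinTrace, Finset.mul_sum]

lemma bilinTrace_zero : bilinTrace b (0 : E →L[ℝ] E →L[ℝ] ℝ) = 0 := by
  simp [bilinTrace]

lemma laplacian_eq_bilinTrace [FiniteDimensional ℝ E] (b : OrthonormalBasis ι ℝ E) (u : E → ℝ) :
    (Laplacian.laplacian u : E → ℝ) = fun x => bilinTrace b (fderiv ℝ (fderiv ℝ u) x) := by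
  funext x
  rw [InnerProductSpace.laplacian_eq_iteratedFDeriv_orthonormalBasis u b]
  simp [bilinTrace, iteratedFDeriv_two_apply]

variable {p q : E →L[ℝ] ℝ} {g : ℝ → ℝ}

/-- The hypothesis says that the quadratic form p q is harmonic. This removes the one Hessian term
that is not bounded uniformly in t. -/
lemma bilinTrace_mulHessian (hpq : ∑ i, p (b i) * q (b i) = 0) :
    bilinTrace b (mulHessian p q) = 0 := by
  have h : ∀ i, mulHessian p q (b i) (b i) = 2 * (p (b i) * q (b i)) := fun i => by
    simp [mulHessian]
    ring
  simp only [bilinTrace, h, ← Finset.mul_sum, hpq, mul_zero]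

lemma radialMul_zero : radialMul p q g 0 = 0 := by simp [radialMul]

lemma radialGrad_zero : radialGrad p q g 0 = 0 := by simp [radialGrad]

lemma hasFDerivAt_radialMul_zero (hp : ‖p‖ ≤ 1) (hq : ‖q‖ ≤ 1) (h0 : Tendsto g atTop (𝓝 0)) :
    HasFDerivAt (radialMul p q g) (0 : E →L[ℝ] ℝ) 0 := by
  refine hasFDerivAt_zero_of_norm_le radialMul_zero fun δ hδ => ?_
  have h1 := (h0.comp (tendsto_neg_log_norm_sq (E := E))).eventually (Metric.ball_mem_nhds 0 hδ)
  filter_upwards [h1, nhdsWithin_le_nhds (Metric.ball_mem_nhds (0 : E) one_pos)] with x hx hx1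
  rw [mem_ball_zero_iff] at hx1
  rw [Function.comp_apply, dist_zero_right, Real.norm_eq_abs] at hx
  rw [radialMul, Real.norm_eq_abs, abs_mul]
  calc |p x * q x| * |g (-Real.log (‖x‖ ^ 2))| ≤ ‖x‖ ^ 2 * δ := by
        gcongr
        exact abs_mul_apply_le hp hq x
    _ = ‖x‖ * (δ * ‖x‖) := by ring
    _ ≤ 1 * (δ * ‖x‖) := by gcongr
    _ = _ := one_mul _

lemma fderiv_radialMul (hp : ‖p‖ ≤ 1) (hq : ‖q‖ ≤ 1) (hg : ContDiff ℝ 2 g)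
    (h0 : Tendsto g atTop (𝓝 0)) : fderiv ℝ (radialMul p q g) = radialGrad p q g := by
  funext x
  rcases eq_or_ne x 0 with rfl | hx
  · rw [(hasFDerivAt_radialMul_zero hp hq h0).fderiv, radialGrad_zero]
  · exact (hasFDerivAt_radialMul hg hx).fderiv

lemma hasFDerivAt_radialGrad_zero (hp : ‖p‖ ≤ 1) (hq : ‖q‖ ≤ 1) (h0 : Tendsto g atTop (𝓝 0))
    (h1 : Tendsto (deriv g) atTop (𝓝 0)) :
    HasFDerivAt (radialGrad p q g) (0 : E →L[ℝ] E →L[ℝ] ℝ) 0 := by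
  refine hasFDerivAt_zero_of_norm_le radialGrad_zero fun δ hδ => ?_
  have h2 : Tendsto (fun s => 2 * (|g s| + |deriv g s|)) atTop (𝓝 0) := by
    simpa using ((h0.abs.add h1.abs).const_mul 2)
  filter_upwards [(h2.comp (tendsto_neg_log_norm_sq (E := E))).eventually_lt_const hδ] with x hx
  refine (norm_radialGrad_le hp hq g x).trans ?_
  gcongr
  exact hx.le

/-- The gradient is o(|x|), so the Hessian at 0 exists and vanishes. Near 0 the Hessian is bounded
by g, g', g'' at s → ∞, so it is continuous there too. -/
lemma contDiff_radialMul (hp : ‖p‖ ≤ 1) (hq : ‖q‖ ≤ 1) (hg : ContDiff ℝ 2 g)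
    (h0 : Tendsto g atTop (𝓝 0)) (h1 : Tendsto (deriv g) atTop (𝓝 0))
    (h2 : Tendsto (deriv (deriv g)) atTop (𝓝 0)) : ContDiff ℝ 2 (radialMul p q g) := by
  have hoff : ∀ x : E, x ≠ 0 → ContDiffAt ℝ 1 (fderiv ℝ (radialMul p q g)) x := fun x hx =>
    (contDiffAt_radialMul hg hx).fderiv_right (by norm_num)
  have hat : HasFDerivAt (fderiv ℝ (radialMul p q g)) (0 : E →L[ℝ] E →L[ℝ] ℝ) 0 := by
    rw [fderiv_radialMul hp hq hg h0]
    exact hasFDerivAt_radialGrad_zero hp hq h0 h1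
  rw [show (2 : WithTop ℕ∞) = 1 + 1 from one_add_one_eq_two.symm, contDiff_succ_iff_fderiv]
  refine ⟨fun x => ?_, by simp, contDiff_one_iff_fderiv.2 ⟨fun x => ?_, ?_⟩⟩
  · rcases eq_or_ne x 0 with rfl | hx
    · exact (hasFDerivAt_radialMul_zero hp hq h0).differentiableAt
    · exact (hasFDerivAt_radialMul hg hx).differentiableAt
  · rcases eq_or_ne x 0 with rfl | hx
    · exact hat.differentiableAt
    · exact (hoff x hx).differentiableAt (by norm_num)
  · rw [continuous_iff_continuousAt]
    intro x
    rcases eq_or_ne x 0 with rfl | hx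
    · rw [continuousAt_iff_punctured_nhds, hat.fderiv]
      have h3 : Tendsto (fun s => 2 * |g s| + (14 * |deriv g s| + 4 * |deriv (deriv g) s|)) atTop
          (𝓝 0) := by
        simpa using (h0.abs.const_mul 2).add ((h1.abs.const_mul 14).add (h2.abs.const_mul 4))
      refine squeeze_zero_norm' ?_ (h3.comp (tendsto_neg_log_norm_sq (E := E)))
      filter_upwards [self_mem_nhdsWithin] with x hx
      obtain ⟨T, hT, hTn⟩ := fderiv_fderiv_radialMul hp hq hg (x := x) hx
      rw [hT]
      refine (norm_bilin_add_le _ _).trans (add_le_add ((norm_bilin_smul_le _ _).trans ?_) hTn)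
      rw [mul_comm]
      simp only
      gcongr
      exact norm_mulHessian_le hp hq
    · exact ((hoff x hx).fderiv_right (m := 0) (by norm_num)).continuousAt

/-- A `C²` function supported in the ball of radius `4/5`, with vanishing value and gradient at `0`,
whose values, gradient and Laplacian are bounded by `K`. -/
structure IsBump (b : OrthonormalBasis ι ℝ E) (w : E → ℝ) (K : ℝ) : Prop where
  contDiff : ContDiff ℝ 2 w
  eq_zero : ∀ x, 4 / 5 ≤ ‖x‖ → w x = 0
  abs_le : ∀ x, |w x| ≤ K
  norm_fderiv_le : ∀ x, ‖fderiv ℝ w x‖ ≤ K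
  abs_trace_le : ∀ x, |bilinTrace b (fderiv ℝ (fderiv ℝ w) x)| ≤ K
  apply_zero : w 0 = 0
  fderiv_zero : fderiv ℝ w 0 = 0

lemma neg_log_norm_sq_lt_half {E : Type*} [NormedAddCommGroup E] {x : E} (hx : 4 / 5 ≤ ‖x‖) :
    -Real.log (‖x‖ ^ 2) < 1 / 2 := by
  have hx0 : 0 < ‖x‖ := by linarith
  -- log(5/4) < 1/4, so |x| ≥ 4/5 forces -log |x|² < 1/2, where ψ vanishes.
  have h1 := Real.log_lt_sub_one_of_pos (x := (5 / 4 : ℝ)) (by norm_num) (by norm_num)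
  have h2 : -Real.log ‖x‖ ≤ Real.log (5 / 4) := by
    rw [← Real.log_inv]
    refine Real.log_le_log (by positivity) ?_
    calc ‖x‖⁻¹ ≤ (4 / 5)⁻¹ := inv_anti₀ (by norm_num) hx
      _ = 5 / 4 := by norm_num
  rw [Real.log_pow]
  push_cast
  linarith

lemma exp_half_log_norm_sq {E : Type*} [NormedAddCommGroup E] {x : E} (hx : x ≠ 0) :
    Real.exp (-(-Real.log (‖x‖ ^ 2)) / 2) = ‖x‖ := by
  rw [Real.log_pow]
  push_cast
  rw [show -(-(2 * Real.log ‖x‖)) / 2 = Real.log ‖x‖ by ring, Real.exp_log (norm_pos_iff.2 hx)]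

/-- The constant does not involve t. Gradients give 8C = 2(2C + 2C); the Laplacian gives 44C = 14·2C
+ 4·4C per dimension. -/
lemma isBump_radialMul_dampedProfile {ψ : ℝ → ℝ} {C t : ℝ} (h : IsTamed ψ C) (ht : 0 < t)
    (ht1 : t ≤ 1) (hp : ‖p‖ ≤ 1) (hq : ‖q‖ ≤ 1) (hpq : ∑ i, p (b i) * q (b i) = 0) :
    IsBump b (radialMul p q (dampedProfile ψ t)) (8 * C + Fintype.card ι * (44 * C)) := by
  have hC := h.nonneg
  have hg := h.contDiff_dampedProfile t
  have h0 := h.tendsto_dampedProfile ht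
  have h1 := h.tendsto_deriv_dampedProfile ht
  have h2 := h.tendsto_deriv_deriv_dampedProfile ht ht1
  have hK : 0 ≤ Fintype.card ι * (44 * C) := by positivity
  have hz : ∀ x : E, 4 / 5 ≤ ‖x‖ → radialMul p q (dampedProfile ψ t) x = 0 := fun x hx => by
    rw [radialMul, dampedProfile, h.eq_zero _ (neg_log_norm_sq_lt_half hx), mul_zero, mul_zero]
  have hgx : ∀ x : E, |dampedProfile ψ t (-Real.log (‖x‖ ^ 2))| * ‖x‖ ≤ 2 * C := fun x => by
    rcases eq_or_ne x 0 with rfl | hx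
    · simpa using hC
    · have := h.exp_mul_abs_dampedProfile_le ht.le (-Real.log (‖x‖ ^ 2))
      rwa [exp_half_log_norm_sq hx, mul_comm] at this
  refine ⟨contDiff_radialMul hp hq hg h0 h1 h2, hz, fun x => ?_, fun x => ?_, fun x => ?_,
    radialMul_zero, (hasFDerivAt_radialMul_zero hp hq h0).fderiv⟩
  · rcases le_or_gt (4 / 5) ‖x‖ with hx | hx
    · rw [hz x hx, abs_zero]
      positivity
    · rw [radialMul, abs_mul]
      have h3 : |p x * q x| * |dampedProfile ψ t (-Real.log (‖x‖ ^ 2))| ≤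
          ‖x‖ ^ 2 * |dampedProfile ψ t (-Real.log (‖x‖ ^ 2))| := by
        gcongr
        exact abs_mul_apply_le hp hq x
      nlinarith [hgx x, norm_nonneg x]
  · rw [fderiv_radialMul hp hq hg h0]
    refine (norm_radialGrad_le hp hq _ x).trans ?_
    rcases le_or_gt (4 / 5) ‖x‖ with hx | hx
    · have hs := neg_log_norm_sq_lt_half hx
      have : deriv (dampedProfile ψ t) (-Real.log (‖x‖ ^ 2)) = 0 := by
        rw [h.deriv_dampedProfile]
        simp only [h.deriv_eq_zero hs, h.eq_zero _ hs, mul_zero, sub_zero]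
      rw [this]
      have h3 := hgx x
      rw [abs_zero]
      linarith
    · have h3 := h.abs_deriv_dampedProfile_le ht.le (-Real.log (‖x‖ ^ 2))
      have h4 : |deriv (dampedProfile ψ t) (-Real.log (‖x‖ ^ 2))| * ‖x‖ ≤ 2 * C * 1 := by
        gcongr
        linarith
      linarith [hgx x]
  · rcases eq_or_ne x 0 with rfl | hx
    · have : fderiv ℝ (fderiv ℝ (radialMul p q (dampedProfile ψ t))) 0 = 0 := by
        rw [fderiv_radialMul hp hq hg h0]
        exact (hasFDerivAt_radialGrad_zero hp hq h0 h1).fderiv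
      rw [this, bilinTrace_zero, abs_zero]
      positivity
    · obtain ⟨T, hT, hTn⟩ := fderiv_fderiv_radialMul hp hq hg hx
      rw [hT, bilinTrace_add, bilinTrace_smul, bilinTrace_mulHessian hpq, mul_zero, zero_add]
      have h3 := h.abs_deriv_dampedProfile_le ht.le (-Real.log (‖x‖ ^ 2))
      have h4 := h.abs_deriv_deriv_dampedProfile_le ht.le ht1 (-Real.log (‖x‖ ^ 2))
      calc |bilinTrace b T| ≤ Fintype.card ι * ‖T‖ := abs_bilinTrace_le b T
        _ ≤ Fintype.card ι * (44 * C) := by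
          gcongr
          linarith
        _ ≤ _ := by linarith

/-- Two applications of the mean value inequality from 0. Used in reverse: a large ratio |w(x)|/|x|²
forces a large Hessian somewhere, without computing it. -/
lemma IsBump.abs_le_of_norm_fderiv_fderiv_le {w : E → ℝ} {K M : ℝ} (h : IsBump b w K)
    (hM : ∀ x, ‖fderiv ℝ (fderiv ℝ w) x‖ ≤ M) (x : E) : |w x| ≤ M * ‖x‖ ^ 2 := by
  have hd : Differentiable ℝ (fderiv ℝ w) :=
    (h.contDiff.fderiv_right (m := 1) (by norm_num)).differentiable (by norm_num)
  have hM0 : 0 ≤ M := (ContinuousLinearMap.opNorm_nonneg _).trans (hM 0)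
  have h1 : ∀ y, ‖fderiv ℝ w y‖ ≤ M * ‖y‖ := fun y => by
    have := convex_univ.norm_image_sub_le_of_norm_fderiv_le (𝕜 := ℝ) (f := fderiv ℝ w)
      (x := (0 : E)) (y := y) (fun z _ => hd z) (fun z _ => hM z) trivial trivial
    simpa [h.fderiv_zero] using this
  have := (convex_closedBall (0 : E) ‖x‖).norm_image_sub_le_of_norm_fderiv_le (𝕜 := ℝ) (f := w)
    (C := M * ‖x‖) (x := (0 : E)) (y := x)
    (fun z _ => h.contDiff.differentiable (by norm_num) z)
    (fun z hz => (h1 z).trans (by gcongr; simpa using hz)) (by simp) (by simp)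
  rw [h.apply_zero, sub_zero, sub_zero] at this
  refine this.trans (le_of_eq ?_)
  ring

end

/-! ### Chains of disjoint rescaled bumps -/

lemma AreScales.R_pos {R r : ℕ → ℝ} (h : AreScales R r) (k : ℕ) : 0 < R k :=
  (h.r_pos k).trans (h.r_lt_R k)

lemma AreScales.add_lt_sub {R r : ℕ → ℝ} (h : AreScales R r) {j k : ℕ} (hjk : j < k) :
    R k + r k < R j - r j :=
  (add_le_add (h.antitone_R hjk) (h.antitone_r hjk)).trans_lt (h.gap j)

lemma AreScales.antitone_sub {R r : ℕ → ℝ} (h : AreScales R r) :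
    Antitone fun k => R k - r k := fun j k hjk => by
  rcases hjk.eq_or_lt with rfl | hjk
  · exact le_rfl
  · have := h.add_lt_sub hjk
    have := h.r_pos k
    change R k - r k ≤ R j - r j
    linarith

section

variable {E : Type*} [NormedAddCommGroup E] [InnerProductSpace ℝ E]
  {ι : Type*} [Fintype ι] {b : OrthonormalBasis ι ℝ E}

/-- The rescaled bump `x ↦ ε ρ² w((x - c) / ρ)`. -/
noncomputable def rescale (w : E → ℝ) (ε ρ : ℝ) (c x : E) : ℝ := ε * ρ ^ 2 * w (ρ⁻¹ • (x - c))

lemma hasFDerivAt_comp_rescale {F : Type*} [NormedAddCommGroup F] [NormedSpace ℝ F] {f : E → F}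
    (hf : Differentiable ℝ f) (a ρ : ℝ) (c x : E) :
    HasFDerivAt (fun x => a • f (ρ⁻¹ • (x - c))) ((a * ρ⁻¹) • fderiv ℝ f (ρ⁻¹ • (x - c))) x := by
  have h1 : HasFDerivAt (fun x : E => ρ⁻¹ • (x - c)) (ρ⁻¹ • ContinuousLinearMap.id ℝ E) x :=
    ((hasFDerivAt_id x).sub_const c).const_smul ρ⁻¹
  refine (((hf _).hasFDerivAt.comp x h1).const_smul a).congr_fderiv ?_
  ext y
  simp [smul_smul]

namespace IsBump

variable {w : E → ℝ} {K ε ρ : ℝ}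

lemma nonneg (h : IsBump b w K) : 0 ≤ K := (abs_nonneg _).trans (h.abs_le 0)

lemma differentiable_fderiv (h : IsBump b w K) : Differentiable ℝ (fderiv ℝ w) :=
  (h.contDiff.fderiv_right (m := 1) (by norm_num)).differentiable (by norm_num)

lemma hasFDerivAt_rescale (h : IsBump b w K) (ε : ℝ) (hρ : 0 < ρ) (c x : E) :
    HasFDerivAt (rescale w ε ρ c) ((ε * ρ) • fderiv ℝ w (ρ⁻¹ • (x - c))) x := by
  have := hasFDerivAt_comp_rescale (h.contDiff.differentiable (by norm_num)) (ε * ρ ^ 2) ρ c x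
  rwa [show ε * ρ ^ 2 * ρ⁻¹ = ε * ρ by field_simp] at this

lemma fderiv_rescale (h : IsBump b w K) (ε : ℝ) (hρ : 0 < ρ) (c : E) :
    fderiv ℝ (rescale w ε ρ c) = fun x => (ε * ρ) • fderiv ℝ w (ρ⁻¹ • (x - c)) :=
  funext fun x => (h.hasFDerivAt_rescale ε hρ c x).fderiv

lemma hasFDerivAt_fderiv_rescale (h : IsBump b w K) (ε : ℝ) (hρ : 0 < ρ) (c x : E) :
    HasFDerivAt (fderiv ℝ (rescale w ε ρ c)) (ε • fderiv ℝ (fderiv ℝ w) (ρ⁻¹ • (x - c))) x := by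
  rw [h.fderiv_rescale ε hρ]
  have := hasFDerivAt_comp_rescale h.differentiable_fderiv (ε * ρ) ρ c x
  rwa [show ε * ρ * ρ⁻¹ = ε by field_simp] at this

lemma contDiff_rescale (h : IsBump b w K) (ε ρ : ℝ) (c : E) :
    ContDiff ℝ 2 (rescale w ε ρ c) := by
  have := h.contDiff
  unfold rescale
  fun_prop

lemma rescale_eq_zero (h : IsBump b w K) (hρ : 0 < ρ) {c x : E} (hx : 4 / 5 * ρ ≤ ‖x - c‖) :
    rescale w ε ρ c x = 0 := by
  rw [rescale, h.eq_zero, mul_zero]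
  rw [norm_smul, norm_inv, Real.norm_eq_abs, abs_of_pos hρ]
  rw [le_inv_mul_iff₀ hρ]
  linarith

end IsBump

/-- The properties of twice differentiable functions with continuous Laplacian and bounded Hessian
that are needed to assemble the example. -/
structure IsTame (b : OrthonormalBasis ι ℝ E) (u : E → ℝ) : Prop where
  hasCompactSupport : HasCompactSupport u
  differentiable : Differentiable ℝ u
  differentiable_fderiv : Differentiable ℝ (fderiv ℝ u)
  continuous_trace : Continuous fun x => bilinTrace b (fderiv ℝ (fderiv ℝ u) x)
  bounded_hessian : ∃ C : ℝ, ∀ x, ‖fderiv ℝ (fderiv ℝ u) x‖ ≤ C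
  hessian_zero : fderiv ℝ (fderiv ℝ u) 0 = 0

lemma IsTame.sub {u v : E → ℝ} (hu : IsTame b u) (hv : IsTame b v) :
    IsTame b (fun x => u x - v x) := by
  have h1 : fderiv ℝ (fun x => u x - v x) = fun x => fderiv ℝ u x - fderiv ℝ v x :=
    funext fun x => fderiv_fun_sub (hu.differentiable x) (hv.differentiable x)
  have h2 : fderiv ℝ (fderiv ℝ (fun x => u x - v x)) =
      fun x => fderiv ℝ (fderiv ℝ u) x - fderiv ℝ (fderiv ℝ v) x := by
    rw [h1]
    exact funext fun x => fderiv_fun_sub (hu.differentiable_fderiv x) (hv.differentiable_fderiv x)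
  refine ⟨?_, hu.differentiable.sub hv.differentiable, ?_, ?_, ?_, ?_⟩
  · exact hu.hasCompactSupport.sub hv.hasCompactSupport
  · rw [h1]
    exact hu.differentiable_fderiv.sub hv.differentiable_fderiv
  · rw [h2]
    simp only [bilinTrace_sub]
    exact hu.continuous_trace.sub hv.continuous_trace
  · obtain ⟨C, hC⟩ := hu.bounded_hessian
    obtain ⟨D, hD⟩ := hv.bounded_hessian
    refine ⟨C + D, fun x => ?_⟩
    rw [h2]
    exact (norm_bilin_sub_le _ _).trans (add_le_add (hC x) (hD x))
  · rw [h2]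
    simp only [hu.hessian_zero, hv.hessian_zero, sub_self]

/-- The sum of the bumps `w k`, rescaled by `r k` and centred at `R k • ζ`. -/
noncomputable def chainSum (w : ℕ → E → ℝ) (R r ε : ℕ → ℝ) (ζ x : E) : ℝ :=
  ∑' k, rescale (w k) (ε k) (r k) (R k • ζ) x

variable {w : ℕ → E → ℝ} {R r ε : ℕ → ℝ} {ζ : E} {K : ℝ}

lemma AreScales.sub_lt_norm (h : AreScales R r) (hζ : 1 ≤ ‖ζ‖) {k : ℕ} {x : E} {a : ℝ}
    (hx : ‖x - R k • ζ‖ ≤ a) : R k - a ≤ ‖x‖ := by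
  have h1 := norm_sub_norm_le (R k • ζ) x
  rw [norm_sub_rev, norm_smul, Real.norm_eq_abs, abs_of_pos (h.R_pos k)] at h1
  nlinarith [h.R_pos k]

/-- As ‖ζ‖ ≥ 1, distinct centres are at least |R j - R k| apart, which exceeds r j + r k by the gap
condition. -/
lemma AreScales.eq_of_mem (h : AreScales R r) (hζ : 1 ≤ ‖ζ‖) {j k : ℕ} {x : E}
    (hj : ‖x - R j • ζ‖ < r j) (hk : ‖x - R k • ζ‖ < r k) : j = k := by
  by_contra hne
  wlog hjk : j < k generalizing j k
  · exact this hk hj (Ne.symm hne) (lt_of_le_of_ne (not_lt.1 hjk) (Ne.symm hne))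
  have h1 := h.add_lt_sub hjk
  have h2 : ‖(R j - R k) • ζ‖ ≤ ‖x - R k • ζ‖ + ‖x - R j • ζ‖ := by
    refine (le_of_eq ?_).trans (norm_sub_le _ _)
    congr 1
    rw [sub_smul]
    abel
  have h3 := h.r_pos k
  have h4 := h.r_pos j
  rw [norm_smul, Real.norm_eq_abs, abs_of_pos (by linarith)] at h2
  nlinarith

lemma AreScales.not_mem_neg (h : AreScales R r) (hζ : 1 ≤ ‖ζ‖) {j k : ℕ} {x : E}
    (hj : ‖x - R j • ζ‖ < r j) : r k ≤ ‖x - R k • -ζ‖ := by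
  by_contra! hk
  have h2 : ‖(R j + R k) • ζ‖ ≤ ‖x - R k • -ζ‖ + ‖x - R j • ζ‖ := by
    refine (le_of_eq ?_).trans (norm_sub_le _ _)
    congr 1
    rw [add_smul, smul_neg]
    abel
  have h3 := h.R_pos k
  have h4 := h.R_pos j
  have h5 := h.r_lt_R k
  have h6 := h.r_lt_R j
  rw [norm_smul, Real.norm_eq_abs, abs_of_pos (by linarith)] at h2
  nlinarith

lemma chainSum_eq_of_mem (h : AreScales R r) (hw : ∀ k, IsBump b (w k) K) (hζ : 1 ≤ ‖ζ‖) {k : ℕ}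
    {x : E} (hx : ‖x - R k • ζ‖ < r k) :
    chainSum w R r ε ζ x = rescale (w k) (ε k) (r k) (R k • ζ) x := by
  refine tsum_eq_single k fun j hj => (hw j).rescale_eq_zero (h.r_pos j) ?_
  by_contra! hlt
  have := h.r_pos j
  exact hj (h.eq_of_mem hζ (by linarith) hx)

lemma chainSum_eventuallyEq_of_mem (h : AreScales R r) (hw : ∀ k, IsBump b (w k) K)
    (hζ : 1 ≤ ‖ζ‖) {k : ℕ} {x : E} (hx : ‖x - R k • ζ‖ < r k) :
    chainSum w R r ε ζ =ᶠ[𝓝 x] rescale (w k) (ε k) (r k) (R k • ζ) := by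
  have : {y : E | ‖y - R k • ζ‖ < r k} ∈ 𝓝 x :=
    (isOpen_lt (by fun_prop) continuous_const).mem_nhds hx
  filter_upwards [this] with y hy using chainSum_eq_of_mem h hw hζ hy

lemma chainSum_eq_zero (h : AreScales R r) (hw : ∀ k, IsBump b (w k) K) {x : E}
    (hx : ∀ k, 4 / 5 * r k ≤ ‖x - R k • ζ‖) : chainSum w R r ε ζ x = 0 := by
  simp only [chainSum, (hw _).rescale_eq_zero (h.r_pos _) (hx _), tsum_zero]

lemma chainSum_zero (h : AreScales R r) (hw : ∀ k, IsBump b (w k) K) (hζ : 1 ≤ ‖ζ‖) :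
    chainSum w R r ε ζ 0 = 0 := by
  refine chainSum_eq_zero h hw fun k => ?_
  rw [zero_sub, norm_neg, norm_smul, Real.norm_eq_abs, abs_of_pos (h.R_pos k)]
  nlinarith [h.R_pos k, h.r_lt_R k]

/-- Centres and radii tend to 0, so only finitely many bumps come near a nonzero point, and these
are disjoint. -/
lemma chainSum_eventuallyEq (h : AreScales R r) (hw : ∀ k, IsBump b (w k) K)
    (hζ : 1 ≤ ‖ζ‖) {x : E} (hx : x ≠ 0) :
    (∃ k, ‖x - R k • ζ‖ ≤ 4 / 5 * r k ∧
      chainSum w R r ε ζ =ᶠ[𝓝 x] rescale (w k) (ε k) (r k) (R k • ζ)) ∨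
    chainSum w R r ε ζ =ᶠ[𝓝 x] fun _ => 0 := by
  by_cases hk : ∃ k, ‖x - R k • ζ‖ ≤ 4 / 5 * r k
  · obtain ⟨k, hk⟩ := hk
    have := h.r_pos k
    exact .inl ⟨k, hk, chainSum_eventuallyEq_of_mem h hw hζ (by linarith)⟩
  · push Not at hk
    right
    have hx0 : 0 < ‖x‖ / 2 := by positivity
    have hlim : Tendsto (fun k => R k * ‖ζ‖ + r k) atTop (𝓝 0) := by
      simpa using (h.tendsto_R.mul_const ‖ζ‖).add h.tendsto_r
    obtain ⟨N, hN⟩ := eventually_atTop.1 (hlim.eventually_lt_const hx0)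
    have h1 : ∀ᶠ y in 𝓝 x, ∀ k ∈ Finset.range N, 4 / 5 * r k < ‖y - R k • ζ‖ := by
      rw [Filter.eventually_all_finset]
      intro k _
      exact (isOpen_lt continuous_const (by fun_prop)).mem_nhds (hk k)
    filter_upwards [h1, Metric.ball_mem_nhds x hx0] with y hy hyx
    refine chainSum_eq_zero h hw fun k => ?_
    rcases lt_or_ge k N with hkN | hkN
    · exact (hy k (Finset.mem_range.2 hkN)).le
    · have h2 := hN k hkN
      have h3 := norm_sub_norm_le y (R k • ζ)
      rw [norm_smul, Real.norm_eq_abs, abs_of_pos (h.R_pos k)] at h3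
      rw [mem_ball_iff_norm, norm_sub_rev] at hyx
      have h4 := norm_sub_norm_le x y
      have := h.r_pos k
      linarith

lemma contDiffAt_chainSum (h : AreScales R r) (hw : ∀ k, IsBump b (w k) K)
    (hζ : 1 ≤ ‖ζ‖) {x : E} (hx : x ≠ 0) : ContDiffAt ℝ 2 (chainSum w R r ε ζ) x := by
  rcases chainSum_eventuallyEq (ε := ε) h hw hζ hx with ⟨k, -, hk⟩ | h0
  · exact ((hw k).contDiff_rescale _ _ _).contDiffAt.congr_of_eventuallyEq hk
  · exact contDiffAt_const.congr_of_eventuallyEq h0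

/-- Pointwise bounds for the sum of rescaled bumps, in terms of the amplitude of a bump which is
active there. -/
lemma chainSum_bounds (h : AreScales R r) (hw : ∀ k, IsBump b (w k) K)
    (hζ : 1 ≤ ‖ζ‖) (hε : ∀ k, 0 < ε k)
    (hH : ∀ k x, ε k * ‖fderiv ℝ (fderiv ℝ (w k)) x‖ ≤ 1) {x : E} (hx : x ≠ 0) {δ : ℝ} (hδ : 0 ≤ δ)
    (hxδ : ∀ k, R k - r k ≤ ‖x‖ → ε k ≤ δ) :
    |chainSum w R r ε ζ x| ≤ δ * K * 25 * ‖x‖ ^ 2 ∧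
    ‖fderiv ℝ (chainSum w R r ε ζ) x‖ ≤ δ * K * 5 * ‖x‖ ∧
    ‖fderiv ℝ (fderiv ℝ (chainSum w R r ε ζ)) x‖ ≤ 1 ∧
    |bilinTrace b (fderiv ℝ (fderiv ℝ (chainSum w R r ε ζ)) x)| ≤ δ * K := by
  have hK := (hw 0).nonneg
  rcases chainSum_eventuallyEq (ε := ε) h hw hζ hx with ⟨k, hk, he⟩ | h0
  · have hr := h.r_pos k
    have hR := h.r_lt_R k
    have h1 := h.sub_lt_norm hζ hk
    -- Support radius 4/5 rather than 1 matters: ‖x‖ ≥ R k - (4/5) r k > r k / 5, so powers of r k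
    -- become powers of ‖x‖.
    have h2 : r k ≤ 5 * ‖x‖ := by linarith
    have h3 : ε k ≤ δ := hxδ k (by linarith)
    have hεk := hε k
    have hd := ((hw k).hasFDerivAt_rescale (ε k) hr (R k • ζ) x).fderiv
    have hdd := ((hw k).hasFDerivAt_fderiv_rescale (ε k) hr (R k • ζ) x).fderiv
    rw [he.fderiv.fderiv_eq, he.fderiv_eq, he.eq_of_nhds, hd, hdd]
    refine ⟨?_, ?_, ?_, ?_⟩
    · rw [rescale, abs_mul, abs_of_nonneg (by positivity)]
      calc _ ≤ δ * (5 * ‖x‖) ^ 2 * K := by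
            gcongr
            exact (hw k).abs_le _
        _ = _ := by ring
    · rw [norm_smul, Real.norm_eq_abs, abs_of_nonneg (by positivity)]
      calc _ ≤ δ * (5 * ‖x‖) * K := by
            gcongr
            exact (hw k).norm_fderiv_le _
        _ = _ := by ring
    · refine (norm_bilin_smul_le _ _).trans ?_
      rw [abs_of_pos hεk]
      exact hH k _
    · rw [bilinTrace_smul, abs_mul, abs_of_pos hεk]
      gcongr
      exact (hw k).abs_trace_le _
  · have h1 : fderiv ℝ (fderiv ℝ (chainSum w R r ε ζ)) x = 0 := by
      rw [h0.fderiv.fderiv_eq]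
      simp
    have h2 : fderiv ℝ (chainSum w R r ε ζ) x = 0 := by
      rw [h0.fderiv_eq]
      simp
    rw [h1, h2, h0.eq_of_nhds, bilinTrace_zero]
    refine ⟨by simp; positivity, by rw [norm_zero]; positivity, ?_, by simp; positivity⟩
    exact (ContinuousLinearMap.opNorm_zero.le).trans zero_le_one

/-- The inner radii R k - r k decrease in k, so a point close to 0 lies out of reach of the first
bumps and meets only small amplitudes. -/
lemma AreScales.eventually_amplitude_le {E : Type*} [NormedAddCommGroup E] (h : AreScales R r) (hε : Tendsto ε atTop (𝓝 0)) {δ : ℝ}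
    (hδ : 0 < δ) : ∀ᶠ x : E in 𝓝[≠] 0, ∀ k, R k - r k ≤ ‖x‖ → ε k ≤ δ := by
  obtain ⟨N, hN⟩ := eventually_atTop.1 (hε.eventually_lt_const hδ)
  filter_upwards [nhdsWithin_le_nhds (Metric.ball_mem_nhds (0 : E) (sub_pos.2 (h.r_lt_R N)))]
    with x hx k hk
  rw [mem_ball_zero_iff] at hx
  refine (hN k ?_).le
  by_contra! hlt
  have := h.antitone_sub hlt.le
  simp only at this
  linarith

lemma isTame_chainSum [FiniteDimensional ℝ E] (h : AreScales R r) (hw : ∀ k, IsBump b (w k) K)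
    (hζ : 1 ≤ ‖ζ‖) (hε : ∀ k, 0 < ε k) (hε0 : Tendsto ε atTop (𝓝 0))
    (hH : ∀ k x, ε k * ‖fderiv ℝ (fderiv ℝ (w k)) x‖ ≤ 1) :
    IsTame b (chainSum w R r ε ζ) := by
  have hK := (hw 0).nonneg
  have hbd : ∀ δ > 0, ∀ᶠ x in 𝓝[≠] (0 : E),
      |chainSum w R r ε ζ x| ≤ δ * K * 25 * ‖x‖ ^ 2 ∧
      ‖fderiv ℝ (chainSum w R r ε ζ) x‖ ≤ δ * K * 5 * ‖x‖ ∧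
      ‖fderiv ℝ (fderiv ℝ (chainSum w R r ε ζ)) x‖ ≤ 1 ∧
      |bilinTrace b (fderiv ℝ (fderiv ℝ (chainSum w R r ε ζ)) x)| ≤ δ * K := by
    intro δ hδ
    filter_upwards [self_mem_nhdsWithin, h.eventually_amplitude_le (E := E) hε0 hδ] with x hx hx'
    exact chainSum_bounds h hw hζ hε hH hx hδ.le hx'
  have hδ : ∀ δ > 0, ∃ δ' > 0, δ' * K * 25 ≤ δ ∧ δ' * K * 5 ≤ δ ∧ δ' * K ≤ δ := by
    intro δ hδ
    have hK' : δ / (25 * (K + 1)) * K * 25 ≤ δ := by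
      have : K / (K + 1) ≤ 1 := div_le_one_of_le₀ (by linarith) (by linarith)
      calc δ / (25 * (K + 1)) * K * 25 = δ * (K / (K + 1)) := by field_simp
        _ ≤ δ * 1 := by gcongr
        _ = δ := mul_one δ
    have hp : 0 < δ / (25 * (K + 1)) := by positivity
    refine ⟨δ / (25 * (K + 1)), hp, hK', ?_, ?_⟩ <;> nlinarith [mul_nonneg hp.le hK]
  have hd0 : HasFDerivAt (chainSum w R r ε ζ) (0 : E →L[ℝ] ℝ) 0 := by
    refine hasFDerivAt_zero_of_norm_le (chainSum_zero h hw hζ) fun δ hδ0 => ?_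
    obtain ⟨δ', h1, h2, -, -⟩ := hδ δ hδ0
    filter_upwards [hbd δ' h1, nhdsWithin_le_nhds (Metric.ball_mem_nhds (0 : E) one_pos)] with x hx
      hx1
    rw [mem_ball_zero_iff] at hx1
    calc ‖chainSum w R r ε ζ x‖ ≤ δ' * K * 25 * ‖x‖ ^ 2 := hx.1
      _ = (δ' * K * 25) * (‖x‖ * ‖x‖) := by ring
      _ ≤ δ * (1 * ‖x‖) := by gcongr
      _ = _ := by ring
  have hdd0 : HasFDerivAt (fderiv ℝ (chainSum w R r ε ζ)) (0 : E →L[ℝ] E →L[ℝ] ℝ) 0 := by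
    refine hasFDerivAt_zero_of_norm_le hd0.fderiv fun δ hδ0 => ?_
    obtain ⟨δ', h1, -, h2, -⟩ := hδ δ hδ0
    filter_upwards [hbd δ' h1] with x hx
    refine hx.2.1.trans ?_
    gcongr
  have hoff : ∀ x : E, x ≠ 0 → ContDiffAt ℝ 1 (fderiv ℝ (chainSum w R r ε ζ)) x := fun x hx =>
    (contDiffAt_chainSum h hw hζ hx).fderiv_right (by norm_num)
  refine ⟨?_, fun x => ?_, fun x => ?_, ?_, ?_, hdd0.fderiv⟩
  · refine HasCompactSupport.of_support_subset_isCompact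
      (isCompact_closedBall (0 : E) (R 0 * ‖ζ‖ + r 0)) fun x hx => ?_
    rw [mem_closedBall_zero_iff]
    by_contra! hlt
    refine hx (chainSum_eq_zero h hw fun k => ?_)
    have h1 := h.antitone_R (Nat.zero_le k)
    have h2 := h.antitone_r (Nat.zero_le k)
    have h3 := norm_sub_norm_le x (R k • ζ)
    rw [norm_smul, Real.norm_eq_abs, abs_of_pos (h.R_pos k)] at h3
    have h4 := h.r_pos k
    nlinarith [norm_nonneg ζ]
  · rcases eq_or_ne x 0 with rfl | hx
    · exact hd0.differentiableAt
    · exact (contDiffAt_chainSum h hw hζ hx).differentiableAt (by norm_num)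
  · rcases eq_or_ne x 0 with rfl | hx
    · exact hdd0.differentiableAt
    · exact (hoff x hx).differentiableAt (by norm_num)
  · rw [continuous_iff_continuousAt]
    intro x
    rcases eq_or_ne x 0 with rfl | hx
    · rw [continuousAt_iff_punctured_nhds, hdd0.fderiv, bilinTrace_zero]
      rw [Metric.tendsto_nhds]
      intro δ hδ0
      obtain ⟨δ', h1, -, -, h2⟩ := hδ (δ / 2) (by positivity)
      filter_upwards [hbd δ' h1] with x hx
      rw [dist_zero_right, Real.norm_eq_abs]
      linarith [hx.2.2.2]
    · exact ((continuous_bilinTrace b).continuousAt).comp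
        ((hoff x hx).fderiv_right (m := 0) (by norm_num)).continuousAt
  · refine ⟨1, fun x => ?_⟩
    rcases eq_or_ne x 0 with rfl | hx
    · rw [hdd0.fderiv]
      exact (ContinuousLinearMap.opNorm_zero.le).trans zero_le_one
    · obtain ⟨C, hC⟩ := hε0.bddAbove_range
      exact (chainSum_bounds h hw hζ hε hH hx (δ := C)
        ((hε 0).le.trans (hC ⟨0, rfl⟩)) fun k _ => hC ⟨k, rfl⟩).2.2.1

end

/-! ### Choice of amplitudes and failure of continuity of the Hessian -/

section

variable {E : Type*} [NormedAddCommGroup E] [InnerProductSpace ℝ E]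
  {ι : Type*} [Fintype ι] {b : OrthonormalBasis ι ℝ E}

lemma IsBump.norm_le_of_hessian_ne_zero {w : E → ℝ} {K : ℝ} (h : IsBump b w K) {y : E}
    (hy : fderiv ℝ (fderiv ℝ w) y ≠ 0) : ‖y‖ ≤ 4 / 5 := by
  by_contra! hlt
  have he : w =ᶠ[𝓝 y] fun _ => 0 := by
    filter_upwards [(isOpen_lt continuous_const continuous_norm).mem_nhds hlt] with z hz using
      h.eq_zero z (le_of_lt hz)
  refine hy ?_
  rw [he.fderiv.fderiv_eq]
  simp

lemma IsBump.exists_norm_hessian_max [FiniteDimensional ℝ E] {w : E → ℝ} {K : ℝ} (h : IsBump b w K) :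
    ∃ y, ∀ x, ‖fderiv ℝ (fderiv ℝ w) x‖ ≤ ‖fderiv ℝ (fderiv ℝ w) y‖ := by
  have hc : Continuous fun x => ‖fderiv ℝ (fderiv ℝ w) x‖ :=
    ((h.contDiff.fderiv_right (m := 1) (by norm_num)).continuous_fderiv (by norm_num)).norm
  have hs : HasCompactSupport fun x => ‖fderiv ℝ (fderiv ℝ w) x‖ := by
    refine HasCompactSupport.of_support_subset_isCompact
      (isCompact_closedBall (0 : E) (4 / 5)) fun x hx => ?_
    rw [mem_closedBall_zero_iff]
    refine h.norm_le_of_hessian_ne_zero fun h0 => hx ?_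
    simp only [h0]
    exact ContinuousLinearMap.opNorm_zero
  exact hc.exists_forall_ge_of_hasCompactSupport hs

/-- At R k • ζ + r k • y k, which tends to 0, the Hessian is ε k times that of w k at y k: the
scaling factors r k cancel and the opposite chain vanishes there. Its norm stays at least c, against
the value 0 at the origin. -/
lemma not_contDiff_chainSum_sub {w : ℕ → E → ℝ} {R r ε : ℕ → ℝ} {ζ : E} {K : ℝ}
    (h : AreScales R r) (hw : ∀ k, IsBump b (w k) K) (hζ : 1 ≤ ‖ζ‖) (hε : ∀ k, 0 < ε k) {y : ℕ → E}
    {c : ℝ} (hc : 0 < c)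
    (hy : ∀ᶠ k in atTop, c ≤ ε k * ‖fderiv ℝ (fderiv ℝ (w k)) (y k)‖)
    (h0 : fderiv ℝ (fderiv ℝ fun x => chainSum w R r ε ζ x - chainSum w R r ε (-ζ) x) 0 = 0) :
    ¬ ContDiff ℝ 2 (fun x => chainSum w R r ε ζ x - chainSum w R r ε (-ζ) x) := by
  intro hcd
  set u : E → ℝ := fun x => chainSum w R r ε ζ x - chainSum w R r ε (-ζ) x with hu
  have hcont : Continuous fun x => ‖fderiv ℝ (fderiv ℝ u) x‖ :=
    ((hcd.fderiv_right (m := 1) (by norm_num)).continuous_fderiv (by norm_num)).norm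
  have hyn : ∀ᶠ k in atTop, ‖y k‖ ≤ 4 / 5 := by
    filter_upwards [hy] with k hk
    refine (hw k).norm_le_of_hessian_ne_zero fun hzero => ?_
    rw [hzero, show ‖(0 : E →L[ℝ] E →L[ℝ] ℝ)‖ = 0 from ContinuousLinearMap.opNorm_zero,
      mul_zero] at hk
    linarith
  have hz : Tendsto (fun k => R k • ζ + r k • y k) atTop (𝓝 0) := by
    have h1 : Tendsto (fun k => R k • ζ) atTop (𝓝 0) := by simpa using h.tendsto_R.smul_const ζ
    have h2 : Tendsto (fun k => r k • y k) atTop (𝓝 0) := by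
      have h3 : Tendsto (fun k => r k * (4 / 5)) atTop (𝓝 0) := by
        simpa using h.tendsto_r.mul_const (4 / 5)
      refine squeeze_zero_norm' ?_ h3
      filter_upwards [hyn] with k hk
      rw [norm_smul, Real.norm_eq_abs, abs_of_pos (h.r_pos k)]
      exact mul_le_mul_of_nonneg_left hk (h.r_pos k).le
    simpa using h1.add h2
  have hlim := (hcont.tendsto 0).comp hz
  rw [h0, show ‖(0 : E →L[ℝ] E →L[ℝ] ℝ)‖ = 0 from ContinuousLinearMap.opNorm_zero] at hlim
  obtain ⟨k, hk, hkc, hkn⟩ := ((hlim.eventually_lt_const hc).and (hy.and hyn)).exists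
  have hr := h.r_pos k
  have hmem : ‖R k • ζ + r k • y k - R k • ζ‖ < r k := by
    rw [add_sub_cancel_left, norm_smul, Real.norm_eq_abs, abs_of_pos hr]
    nlinarith
  have he : u =ᶠ[𝓝 (R k • ζ + r k • y k)] rescale (w k) (ε k) (r k) (R k • ζ) := by
    have hn : {x : E | ‖x - R k • ζ‖ < r k} ∈ 𝓝 (R k • ζ + r k • y k) :=
      (isOpen_lt (by fun_prop) continuous_const).mem_nhds hmem
    filter_upwards [hn] with x hx
    have h1 : chainSum w R r ε (-ζ) x = 0 := chainSum_eq_zero h hw fun j => by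
      have := h.not_mem_neg hζ (k := j) hx
      have := h.r_pos j
      linarith
    simp only [hu, h1, sub_zero]
    exact chainSum_eq_of_mem h hw hζ hx
  simp only [Function.comp_apply] at hk
  rw [he.fderiv.fderiv_eq, ((hw k).hasFDerivAt_fderiv_rescale (ε k) hr _ _).fderiv,
    add_sub_cancel_left, inv_smul_smul₀ hr.ne', norm_bilin_smul, abs_of_pos (hε k)] at hk
  linarith

/-- If uniformly controlled bumps `w k` are not uniformly `O(|x|²)`, then suitable amplitudes make
the sum of rescaled bumps twice differentiable but not `C²`. -/
lemma exists_amplitudes [FiniteDimensional ℝ E] {w : ℕ → E → ℝ} {R r : ℕ → ℝ} {ζ : E} {K : ℝ}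
    (h : AreScales R r) (hw : ∀ k, IsBump b (w k) K) (hζ : 1 ≤ ‖ζ‖)
    (hlarge : ∀ A : ℝ, ∀ᶠ k in atTop, ∃ x, A * ‖x‖ ^ 2 < |w k x|) :
    ∃ ε : ℕ → ℝ, (∀ k, 0 < ε k) ∧ Tendsto ε atTop (𝓝 0) ∧
      IsTame b (fun x => chainSum w R r ε ζ x - chainSum w R r ε (-ζ) x) ∧
      ¬ ContDiff ℝ 2 (fun x => chainSum w R r ε ζ x - chainSum w R r ε (-ζ) x) := by
  choose y hy using fun k => (hw k).exists_norm_hessian_max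
  set M : ℕ → ℝ := fun k => ‖fderiv ℝ (fderiv ℝ (w k)) (y k)‖ with hM
  have hM0 : ∀ k, 0 ≤ M k := fun k => ContinuousLinearMap.opNorm_nonneg _
  have hMtop : Tendsto M atTop atTop := by
    refine tendsto_atTop.2 fun A => ?_
    filter_upwards [hlarge A] with k ⟨x, hx⟩
    by_contra! hlt
    have h1 := (hw k).abs_le_of_norm_fderiv_fderiv_le (hy k) x
    have h2 : M k * ‖x‖ ^ 2 ≤ A * ‖x‖ ^ 2 := by gcongr
    linarith
  -- The amplitude is the inverse of the maximal Hessian norm, shifted by 1 to stay positive. Thus ε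
  -- k * M k is at most 1, and at least 1/2 once M k ≥ 1.
  have hε : ∀ k, 0 < (1 + M k)⁻¹ := fun k => inv_pos.2 (by linarith [hM0 k])
  have hε0 : Tendsto (fun k => (1 + M k)⁻¹) atTop (𝓝 0) :=
    tendsto_inv_atTop_zero.comp (tendsto_atTop_add_const_left _ 1 hMtop)
  have hH : ∀ k x, (1 + M k)⁻¹ * ‖fderiv ℝ (fderiv ℝ (w k)) x‖ ≤ 1 := fun k x => by
    rw [inv_mul_le_iff₀ (by linarith [hM0 k])]
    linarith [hy k x]
  have hζ' : 1 ≤ ‖-ζ‖ := by rwa [norm_neg]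
  have hT := (isTame_chainSum h hw hζ hε hε0 hH).sub (isTame_chainSum h hw hζ' hε hε0 hH)
  refine ⟨fun k => (1 + M k)⁻¹, hε, hε0, hT,
    not_contDiff_chainSum_sub h hw hζ hε (y := y) (c := 1 / 2) (by norm_num) ?_ hT.hessian_zero⟩
  filter_upwards [hMtop.eventually_ge_atTop 1] with k hk
  change 1 / 2 ≤ (1 + M k)⁻¹ * M k
  rw [le_inv_mul_iff₀ (by linarith)]
  linarith

end

/-! ### Specialisation to the bumps in Euclidean space -/

/-- Along e the ratio to |x|² is half the damped profile. Fix s with ψ(s) > 2A, then let the damping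
tend to 0 at this s. -/
lemma eventually_exists_lt_abs_radialMul {E : Type*} [NormedAddCommGroup E]
    [InnerProductSpace ℝ E] {p q : E →L[ℝ] ℝ} {e : E} (he : ‖e‖ = 1) (hpq : p e * q e = 1 / 2)
    {ψ : ℝ → ℝ} (hψ : Tendsto ψ atTop atTop) {t : ℕ → ℝ} (ht : Tendsto t atTop (𝓝 0)) (A : ℝ) :
    ∀ᶠ k in atTop, ∃ x, A * ‖x‖ ^ 2 < |radialMul p q (dampedProfile ψ (t k)) x| := by
  obtain ⟨s, hs⟩ := (hψ.eventually_gt_atTop (2 * A)).exists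
  have hlim : Tendsto (fun k => dampedProfile ψ (t k) s) atTop (𝓝 (ψ s)) := by
    have h1 : Continuous fun τ => dampedProfile ψ τ s := by
      unfold dampedProfile
      fun_prop
    have h2 := (h1.tendsto 0).comp ht
    simpa [dampedProfile, Function.comp_def] using h2
  filter_upwards [hlim.eventually_const_lt hs] with k hk
  refine ⟨Real.exp (-s / 2) • e, ?_⟩
  have hn : ‖Real.exp (-s / 2) • e‖ = Real.exp (-s / 2) := by
    rw [norm_smul, he, mul_one, Real.norm_eq_abs, Real.abs_exp]
  have hL : -Real.log (Real.exp (-s / 2) ^ 2) = s := by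
    rw [Real.log_pow, Real.log_exp]
    push_cast
    ring
  refine lt_of_lt_of_le ?_ (le_abs_self _)
  rw [radialMul, hn, hL, map_smul, map_smul, smul_eq_mul, smul_eq_mul,
    show Real.exp (-s / 2) * p e * (Real.exp (-s / 2) * q e) =
      Real.exp (-s / 2) ^ 2 * (p e * q e) by ring, hpq]
  have := Real.exp_pos (-s / 2)
  have h3 : 0 < Real.exp (-s / 2) ^ 2 := by positivity
  nlinarith

lemma bump_eq_radialMul {n : ℕ} (hn : 2 ≤ n) {φ η : ℝ → ℝ} (hη : IsCutoff η) (t : ℝ) :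
    bump hn φ η t = radialMul (EuclideanSpace.proj (⟨0, by omega⟩ : Fin n))
      (EuclideanSpace.proj (⟨1, by omega⟩ : Fin n))
      (dampedProfile (fun s => η (Real.exp (-s / 2)) * φ s) t) := by
  funext x
  rw [bump, radialMul, dampedProfile]
  split_ifs with h0 h1
  · simp [h0]
  · rw [exp_half_log_norm_sq h0, Real.rpow_def_of_pos (norm_pos_iff.2 h0)]
    rw [show -(t * -Real.log (‖x‖ ^ 2)) = Real.log ‖x‖ * (2 * t) by
      rw [Real.log_pow]; push_cast; ring]
    simp only [PiLp.proj_apply]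
    ring
  · rw [exp_half_log_norm_sq h0, hη.eq_zero _ (by linarith)]
    simp

lemma bumpSum_eq_chainSum_sub {n : ℕ} (hn : 2 ≤ n) (φ η : ℝ → ℝ) (R r t ε : ℕ → ℝ) :
    bumpSum hn φ η R r t ε = fun x =>
      chainSum (fun k => bump hn φ η (t k)) R r ε (diagPoint n) x -
        chainSum (fun k => bump hn φ η (t k)) R r ε (-diagPoint n) x := by
  funext x
  simp only [bumpSum, chainSum, rescale, smul_neg, sub_neg_eq_add]

lemma one_le_norm_diagPoint {n : ℕ} (hn : 2 ≤ n) : 1 ≤ ‖diagPoint n‖ := by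
  have h1 : ‖diagPoint n‖ ^ 2 = n * (1 / 2) := by
    rw [EuclideanSpace.norm_sq_eq]
    simp [diagPoint]
  have h2 : (2 : ℝ) ≤ n := by exact_mod_cast hn
  nlinarith [norm_nonneg (diagPoint n)]

lemma norm_euclidean_proj_le {n : ℕ} (i : Fin n) :
    ‖(EuclideanSpace.proj i : EuclideanSpace ℝ (Fin n) →L[ℝ] ℝ)‖ ≤ 1 :=
  ContinuousLinearMap.opNorm_le_bound _ zero_le_one fun x => by
    simpa using PiLp.norm_apply_le x i

lemma isNonC2Example_of_isTame {n : ℕ} {u : EuclideanSpace ℝ (Fin n) → ℝ}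
    (h : IsTame (EuclideanSpace.basisFun (Fin n) ℝ) u) (hu : ¬ ContDiff ℝ 2 u) :
    IsNonC2Example u :=
  ⟨h.hasCompactSupport, h.differentiable, h.differentiable_fderiv, by
    rw [laplacian_eq_bilinTrace (EuclideanSpace.basisFun (Fin n) ℝ)]
    exact h.continuous_trace, h.bounded_hessian, hu⟩

lemma exists_isNonC2Example_bumpSum {n : ℕ} (hn : 2 ≤ n) {φ η : ℝ → ℝ} {R r t : ℕ → ℝ}
    (hφ : IsProfile φ) (hη : IsCutoff η) (h : AreScales R r) (ht : ∀ k, 0 < t k ∧ t k < 1 / 4)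
    (ht0 : Tendsto t atTop (𝓝 0)) :
    ∃ ε : ℕ → ℝ, (∀ k, 0 < ε k) ∧ Tendsto ε atTop (𝓝 0) ∧
      IsNonC2Example (bumpSum hn φ η R r t ε) := by
  obtain ⟨⟨C, hC⟩, htop⟩ := exists_isTamed hφ hη
  have hne : (⟨0, by omega⟩ : Fin n) ≠ ⟨1, by omega⟩ := by simp
  have hw : ∀ k, IsBump (EuclideanSpace.basisFun (Fin n) ℝ) (bump hn φ η (t k))
      (8 * C + Fintype.card (Fin n) * (44 * C)) := fun k => by
    rw [bump_eq_radialMul hn hη]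
    refine isBump_radialMul_dampedProfile hC (ht k).1 (by linarith [(ht k).2])
      (norm_euclidean_proj_le _) (norm_euclidean_proj_le _) (Finset.sum_eq_zero fun i _ => ?_)
    rcases eq_or_ne i ⟨0, by omega⟩ with rfl | hi
    · simp [hne.symm]
    · simp [hi.symm]
  have hlarge : ∀ A : ℝ, ∀ᶠ k in atTop, ∃ x, A * ‖x‖ ^ 2 < |bump hn φ η (t k) x| := by
    simp only [bump_eq_radialMul hn hη]
    set i : Fin n := ⟨0, by omega⟩
    set j : Fin n := ⟨1, by omega⟩
    have h2 : (0 : ℝ) < Real.sqrt 2 := by positivity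
    have h22 : (Real.sqrt 2) ^ 2 = 2 := Real.sq_sqrt zero_le_two
    -- The unit vector on the diagonal of the first two coordinates, where x₁x₂ = 1/2.
    set e : EuclideanSpace ℝ (Fin n) := EuclideanSpace.single i (Real.sqrt 2)⁻¹ +
      EuclideanSpace.single j (Real.sqrt 2)⁻¹ with he
    have hei : e i = (Real.sqrt 2)⁻¹ := by simp [he, hne]
    have hej : e j = (Real.sqrt 2)⁻¹ := by simp [he, hne.symm]
    refine eventually_exists_lt_abs_radialMul (e := e) ?_ ?_ htop ht0
    · have h3 : ‖e‖ ^ 2 = 1 := by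
        rw [← real_inner_self_eq_norm_sq]
        nth_rewrite 1 [he]
        rw [inner_add_left, EuclideanSpace.inner_single_left, EuclideanSpace.inner_single_left,
          hei, hej]
        simp only [conj_trivial]
        field_simp
        linarith
      nlinarith [norm_nonneg e]
    · simp only [PiLp.proj_apply, hei, hej]
      field_simp
      linarith
  obtain ⟨ε, h1, h2, h3, h4⟩ := exists_amplitudes h hw (one_le_norm_diagPoint hn) hlarge
  refine ⟨ε, h1, h2, ?_⟩
  rw [bumpSum_eq_chainSum_sub]
  exact isNonC2Example_of_isTame h3 h4

lemma isCutoff_smoothTransition : IsCutoff fun s => 1 - Real.smoothTransition (6 * s - 3) where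
  contDiffOn := by
    have : ContDiff ℝ ∞ Real.smoothTransition := Real.smoothTransition.contDiff
    fun_prop
  antitoneOn := fun s _ s' _ hs =>
    sub_le_sub_left (Real.smoothTransition.monotone (by linarith)) 1
  mapsTo := fun s _ => ⟨sub_nonneg.2 (Real.smoothTransition.le_one _),
    sub_le_self _ (Real.smoothTransition.nonneg _)⟩
  eq_one := fun s _ hs => by
    simp [Real.smoothTransition.zero_of_nonpos (x := 6 * s - 3) (by linarith)]
  eq_zero := fun s hs => by
    simp [Real.smoothTransition.one_of_one_le (x := 6 * s - 3) (by linarith)]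

lemma areScales_geometric :
    AreScales (fun k => (1 / 4 : ℝ) ^ k) (fun k => (1 / 4 : ℝ) ^ k * (1 / 4)) where
  r_pos k := by positivity
  r_lt_R k := by
    have : (0 : ℝ) < (1 / 4) ^ k := by positivity
    linarith
  antitone_R := pow_right_anti₀ (by norm_num) (by norm_num)
  antitone_r := (pow_right_anti₀ (by norm_num) (by norm_num)).mul_const (by norm_num)
  tendsto_R := tendsto_pow_atTop_nhds_zero_of_lt_one (by norm_num) (by norm_num)
  tendsto_r := by
    simpa only [zero_mul] using (tendsto_pow_atTop_nhds_zero_of_lt_one (r := (1 / 4 : ℝ)) (by norm_num)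
      (by norm_num)).mul_const (1 / 4)
  gap k := by
    have : (0 : ℝ) < (1 / 4) ^ k := by positivity
    rw [pow_succ]
    linarith

theorem mainTheorem1 (n : ℕ) (hn : 2 ≤ n) (φ : ℝ → ℝ) (hφ : IsProfile φ) :
    (∃ u : EuclideanSpace ℝ (Fin n) → ℝ, IsNonC2Example u) ∧
    ∀ (η : ℝ → ℝ) (R r t : ℕ → ℝ), IsCutoff η → AreScales R r →
      (∀ k, 0 < t k ∧ t k < 1 / 4) → Tendsto t atTop (𝓝 0) →
      ∃ ε : ℕ → ℝ, (∀ k, 0 < ε k) ∧ Tendsto ε atTop (𝓝 0) ∧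
        IsNonC2Example (bumpSum hn φ η R r t ε) := by
  refine ⟨?_, fun η R r t hη h ht ht0 => exists_isNonC2Example_bumpSum hn hφ hη h ht ht0⟩
  -- The damping 1/(5(k + 1)) is at most 1/5, hence below 1/4.
  obtain ⟨ε, -, -, hu⟩ := exists_isNonC2Example_bumpSum hn (t := fun k : ℕ => 1 / ((k : ℝ) + 1) / 5)
    hφ isCutoff_smoothTransition areScales_geometric (fun k => ⟨by positivity, by
      have : 1 / ((k : ℝ) + 1) ≤ 1 := div_le_one_of_le₀ (by simp) (by positivity)
      linarith⟩)
    (by simpa using (tendsto_one_div_add_atTop_nhds_zero_nat (𝕜 := ℝ)).div_const 5)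
  exact ⟨_, hu⟩
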